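/- Theorem (Left $\mathcal B_-(\lambda|\beta)$ SOV-basis). Setting. Let $\mathsf N\ge 0$ and $\mathcal H=(\mathbb C^2)^{\otimes \mathsf N}$, and fix complex parameters $\eta,\xi_1,\dots,\xi_{\mathsf N},\zeta_-,\kappa_-,\tau_-,\alpha,\beta$ with $\sinh\zeta_-\neq0$, $\kappa_-\ne 0$. Let $$R(\lambda)=\begin{pmatrix}\sinh(\lambda+\eta)&0&0&0\\0&\sinh\lambda&\sinh\eta&0\\0&\sinh\eta&\sinh\lambda&0\\0&0&0&\sinh(\lambda+\eta)\end{pmatrix},\qquad K_-(\lambda)=\frac1{\sinh\zeta_-}\begin{pmatrix}\sinh(\lambda-\eta/2+\zeta_-)&\kappa_-e^{\tau_-}\sinh(2\lambda-\eta)\\ \kappa_-e^{-\tau_-}\sinh(2\lambda-\eta)&\sinh(\zeta_--\lambda+\eta/2)\end{pmatrix},$$ and, on $\mathbb C^2_0\otimes\mathcal H$, $M(\lambda)=R_{0\mathsf N}(\lambda-\xi_{\mathsf N}-\eta/2)\cdots R_{01}(\lambda-\xi_1-\eta/2)$, $\hat M(\lambda)=(-1)^{\mathsf N}\sigma_0^yM^{t_0}(-\lambda)\sigma_0^y$,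 $\mathcal U_-(\lambda)=M(\lambda)K_-(\lambda)\hat M(\lambda)$. Let $$\tilde G(\lambda|\beta)=\begin{pmatrix}e^{-\lambda-(\alpha+\beta+1)\eta}&e^{-\lambda-(\alpha-\beta+1)\eta}\\1&1\end{pmatrix},$$ and define the operators $\mathcal A_-,\mathcal B_-$ (and $\mathcal C_-,\mathcal D_-$) on $\mathcal H$ by $$e^{-\lambda+\eta/2}\,\tilde G^{-1}(\lambda-\eta/2|\beta)\,\mathcal U_-(\lambda)\,\tilde G(\eta/2-\lambda|\beta)=\begin{pmatrix}\mathcal A_-(\lambda|\beta+2)&\mathcal B_-(\lambda|\beta)\\ \mathcal C_-(\lambda|\beta+2)&\mathcal D_-(\lambda|\beta)\end{pmatrix}.$$ Let $\alpha_-,\beta_-$ be any complex numbers with $\sinh\alpha_-\cosh\beta_-=\frac{\sinh\zeta_-}{2\kappa_-}$ and $\cosh\alpha_-\sinh\beta_-=\frac{\cosh\zeta_-}{2\kappa_-}$, and put $a(\lambda)=\prod_{n=1}^{\mathsf N}\sinh(\lambda-\xi_n+\eta/2)$, $d(\lambda)=a(\lambda-\eta)$, $g_-(\lambda)=\frac{\sinh(\lambda+\alpha_--\eta/2)\cosh(\lambda+\beta_--\eta/2)}{\sinh\alpha_-\cosh\beta_-}$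 and $\mathsf A_-(\lambda)=g_-(\lambda)a(\lambda)d(-\lambda)$. Finally let $\langle\beta|=\bigotimes_{n=1}^{\mathsf N}\bigl(-1,\;e^{-\alpha\eta+(\mathsf N-n+\beta)\eta-\xi_n}\bigr)_{(n)}$ and, for $\mathbf h\in\{0,1\}^{\mathsf N}$, $$\langle\beta,\mathbf h|=\langle\beta|\prod_{n=1}^{\mathsf N}\left(\frac{\mathcal A_-(\eta/2-\xi_n|\beta+2)}{\mathsf A_-(\eta/2-\xi_n)}\right)^{h_n},\qquad a_{\mathbf h}(\lambda)=\prod_{n=1}^{\mathsf N}\sinh\bigl(\lambda-\xi_n-(h_n-\tfrac12)\eta\bigr).$$ Assumptions. (i) $\xi_a\ne\xi_b+r\eta+i\pi k$ for all $a\neq b$, $r\in\{-1,0,1\}$, $k\in\mathbb Z$; (ii) $\xi_a+\xi_b\neq i\pi k$ for all $a,b$ (including $a=b$) and $k\in\mathbb Z$; (iii) $\mathsf A_-(\eta/2-\xi_n)\neq0$ for all $n$; (iv) $\sinh(\beta\eta)\ne0$ and $\sinh((\beta-2)\eta)\neq0$. Conclusions. The states $\langle\beta,\mathbf h|$ do not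 depend on the order of the factors in the product. They are left pseudo-eigenstates of $\mathcal B_-(\lambda|\beta)$: for all $\mathbf h\in\{0,1\}^{\mathsf N}$ and $\lambda\in\mathbb C$, $$\langle\beta,\mathbf h|\,\mathcal B_-(\lambda|\beta)=\mathsf B_{\mathbf h}(\lambda|\beta)\,\langle\beta-2,\mathbf h|,$$ $$\mathsf B_{\mathbf h}(\lambda|\beta)=(-1)^{\mathsf N}e^{(\beta+\mathsf N)\eta}\,a_{\mathbf h}(\lambda)\,a_{\mathbf h}(-\lambda)\,\frac{\sinh(2\lambda-\eta)\bigl(2\kappa_-\sinh[(\mathsf N+\beta-\alpha-1)\eta-\tau_-]-e^{\zeta_-}\bigr)}{2\sinh\zeta_-\,\sinh(\beta\eta)}.$$ If moreover, for all $j\in\{0,\dots,\mathsf N-1\}$ and $k\in\mathbb Z$, $$(\alpha-(\beta-2j))\eta\neq(\mathsf N-1)\eta-\tau_--(-1)^k(\alpha_-+\beta_-)+i\pi k,$$ then the $2^{\mathsf N}$ states $\langle\beta,\mathbf h|$, $\mathbf h\in\{0,1\}^{\mathsf N}$, form a basis of the space of left states (row vectors) of $\mathcal H$. -/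

import Mathlib

open Complex

noncomputable section

namespace OpenXXZ

/-- Operators on the quantum space `ℋ = (ℂ²)^{⊗N}`, written in the standard spin basis: a basis
vector is a spin configuration `Fin N → Fin 2`, where `0` is the first basis vector of `ℂ²`.
Vectors and covectors of `ℋ` are functions `(Fin N → Fin 2) → ℂ`; covectors (left states) are
acted on from the right by `Matrix.vecMul`. -/
abbrev Op (N : ℕ) := Matrix (Fin N → Fin 2) (Fin N → Fin 2) ℂ

/-- Operators on `ℋ₀ ⊗ ℋ`, with `ℋ₀ = ℂ²` the auxiliary space, as `2 × 2` matrices whose entries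
are operators on `ℋ`. -/
abbrev AuxOp (N : ℕ) := Matrix (Fin 2) (Fin 2) (Op N)

/-- The operator acting as the `2 × 2` matrix `m` on the `n`-th tensor factor of `ℋ` and as the
identity on all the other factors. -/
def site {N : ℕ} (n : Fin N) (m : Matrix (Fin 2) (Fin 2) ℂ) : Op N :=
  fun s t => if ∀ k, k ≠ n → s k = t k then m (s n) (t n) else 0

/-- A `2 × 2` scalar matrix seen as an operator acting on the auxiliary space only. -/
def aux (N : ℕ) (m : Matrix (Fin 2) (Fin 2) ℂ) : AuxOp N :=
  fun i j => m i j • (1 : Op N)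

/-- The parameters of the chain: the anisotropy `η`, the inhomogeneities `ξ₁, …, ξ_N`, the
parameters `ζ₋, κ₋, τ₋` of the boundary matrix `K₋`, and the gauge parameter `α`. -/
structure Chain (N : ℕ) where
  η : ℂ
  ξ : Fin N → ℂ
  ζ : ℂ
  κ : ℂ
  τ : ℂ
  α : ℂ

/-- The six-vertex trigonometric `R`-matrix on `ℂ² ⊗ ℂ²`, in the basis `00, 01, 10, 11`. -/
def rMatrix (η x : ℂ) : Matrix (Fin 2 × Fin 2) (Fin 2 × Fin 2) ℂ :=
  (!![sinh (x + η), 0, 0, 0;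
      0, sinh x, sinh η, 0;
      0, sinh η, sinh x, 0;
      0, 0, 0, sinh (x + η)] : Matrix (Fin (2 * 2)) (Fin (2 * 2)) ℂ).submatrix
    finProdFinEquiv finProdFinEquiv

/-- The scalar reflection matrix `K(x; ζ, κ, τ)`. -/
def kMatrix (η ζ κ τ x : ℂ) : Matrix (Fin 2) (Fin 2) ℂ :=
  (1 / sinh ζ) • !![sinh (x - η / 2 + ζ), κ * exp τ * sinh (2 * x - η);
                    κ * exp (-τ) * sinh (2 * x - η), sinh (ζ - x + η / 2)]

/-- The Pauli matrix `σ^y`. -/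
def pauliY : Matrix (Fin 2) (Fin 2) ℂ := !![0, -I; I, 0]

namespace Chain

variable {N : ℕ} (c : Chain N)

/-- `R₀ₙ(x)`, acting on the auxiliary space and on the `n`-th site. -/
def R0 (n : Fin N) (x : ℂ) : AuxOp N :=
  fun i j => site n (Matrix.of fun a b => rMatrix c.η x (i, a) (j, b))

/-- The bulk monodromy matrix
`M(x) = R₀_N(x - ξ_N - η/2) ⋯ R₀₁(x - ξ₁ - η/2)`. -/
def M (x : ℂ) : AuxOp N :=
  ((List.finRange N).reverse.map fun n => c.R0 n (x - c.ξ n - c.η / 2)).prod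

/-- `M̂(x) = (-1)^N σ₀^y M^{t₀}(-x) σ₀^y`; the transposition is in the auxiliary space only. -/
def Mhat (x : ℂ) : AuxOp N :=
  (-1 : ℂ) ^ N • (aux N pauliY * (c.M (-x)).transpose * aux N pauliY)

/-- The boundary monodromy matrix `𝒰₋(x) = M(x) K₋(x) M̂(x)`. -/
def U (x : ℂ) : AuxOp N :=
  c.M x * aux N (kMatrix c.η c.ζ c.κ c.τ x) * c.Mhat x

/-- The gauge column `X(x|β)`. -/
def X (x β : ℂ) : Fin 2 → ℂ := ![exp (-(x + (c.α + β) * c.η)), 1]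

/-- The gauge column `Y(x|β)`. -/
def Y (x β : ℂ) : Fin 2 → ℂ := ![exp (-(x + (c.α - β) * c.η)), 1]

/-- The gauge matrix `G̃(x|β)`, with columns `X(x|β+1)` and `Y(x|β-1)`. Its determinant is
a nonzero multiple of `sinh (βη)`. -/
def Gtilde (x β : ℂ) : Matrix (Fin 2) (Fin 2) ℂ :=
  (Matrix.of ![c.X x (β + 1), c.Y x (β - 1)]).transpose

/-- The normalized gauge transformed boundary monodromy matrix
`𝒰₋(x|β) = e^{-x+η/2} G̃⁻¹(x-η/2|β) 𝒰₋(x) G̃(η/2-x|β)`. Its entries are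
`𝒜₋(x|β+2)`, `ℬ₋(x|β)` in the first row and `𝒞₋(x|β+2)`, `𝒟₋(x|β)` in the second one. -/
def gaugedU (x β : ℂ) : AuxOp N :=
  exp (-x + c.η / 2) •
    (aux N (c.Gtilde (x - c.η / 2) β)⁻¹ * c.U x * aux N (c.Gtilde (c.η / 2 - x) β))

/-- The gauge transformed generator `𝒜₋(x|β)`. -/
def opA (x β : ℂ) : Op N := c.gaugedU x (β - 2) 0 0

/-- The gauge transformed generator `ℬ₋(x|β)`. -/
def opB (x β : ℂ) : Op N := c.gaugedU x β 0 1

/-- The function `a(x) = ∏ₙ sinh (x - ξₙ + η/2)`. -/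
def a (x : ℂ) : ℂ := ∏ n, sinh (x - c.ξ n + c.η / 2)

/-- The function `d(x) = a(x - η)`. -/
def d (x : ℂ) : ℂ := c.a (x - c.η)

/-- The function `g₋(x)`, in terms of the boundary parameters `α₋` and `β₋`. -/
def g (αm βm x : ℂ) : ℂ :=
  sinh (x + αm - c.η / 2) * cosh (x + βm - c.η / 2) / (sinh αm * cosh βm)

/-- The scalar function `𝖠₋(x) = g₋(x) a(x) d(-x)`. -/
def scalarA (αm βm x : ℂ) : ℂ := c.g αm βm x * c.a x * c.d (-x)

/-- The left reference state `⟨β| = ⊗ₙ (-1, e^{-αη + (N-n+β)η - ξₙ})`, `n = 1, …, N`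
(the site `n` is the element `n - 1` of `Fin N`). -/
def refState (β : ℂ) : (Fin N → Fin 2) → ℂ :=
  fun s => ∏ n : Fin N,
    (![-1, exp (-c.α * c.η + ((N : ℂ) - ((n : ℕ) + 1 : ℂ) + β) * c.η - c.ξ n)] :
      Fin 2 → ℂ) (s n)

/-- The state `⟨β| ∏ₙ (𝒜₋(η/2-ξₙ|β+2) / 𝖠₋(η/2-ξₙ))^{hₙ}`, where the factors are multiplied
from left to right in the order `n = σ(1), …, σ(N)`. -/
def sovStateOrdered (αm βm : ℂ) (σ : Equiv.Perm (Fin N)) (β : ℂ) (h : Fin N → Fin 2) :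
    (Fin N → Fin 2) → ℂ :=
  Matrix.vecMul (c.refState β)
    (((List.finRange N).map fun k =>
      ((c.scalarA αm βm (c.η / 2 - c.ξ (σ k)))⁻¹ •
        c.opA (c.η / 2 - c.ξ (σ k)) (β + 2)) ^ (h (σ k) : ℕ)).prod)

/-- The state `⟨β,h|`, with the factors in the order `n = 1, …, N`. -/
def sovState (αm βm β : ℂ) (h : Fin N → Fin 2) : (Fin N → Fin 2) → ℂ :=
  c.sovStateOrdered αm βm 1 β h

/-- The function `a_h(x) = ∏ₙ sinh (x - ξₙ - (hₙ - 1/2) η)`. -/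
def ah (h : Fin N → Fin 2) (x : ℂ) : ℂ :=
  ∏ n, sinh (x - c.ξ n - (((h n : ℕ) : ℂ) - 1 / 2) * c.η)

/-- The pseudo-eigenvalue `𝖡_h(x|β)`. -/
def pseudoEigenvalue (h : Fin N → Fin 2) (x β : ℂ) : ℂ :=
  (-1 : ℂ) ^ N * exp ((β + N) * c.η) * c.ah h x * c.ah h (-x) *
    (sinh (2 * x - c.η) *
      (2 * c.κ * sinh (((N : ℂ) + β - c.α - 1) * c.η - c.τ) - exp c.ζ) /
      (2 * sinh c.ζ * sinh (β * c.η)))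

end Chain

end OpenXXZ

end

noncomputable section

namespace OpenXXZ

/-! Both gauge-transformed operators come from the first row of G̃⁻¹𝒰₋G̃ and are governed by the
single parameter T = e^{-(α-β+1)η}. `opB` is a multiple of `hatB T`, and `opA` at β + 2 is a
combination of `hatA T` and `hatB T` (`opB_eq`, `opA_eq`). The shift β → β - 2 becomes T → T
e^{-2η}.

The local covectors of ⟨β| are intertwining vectors of the R-matrix, so `hatB` passes through the
sites one by one (`tensorLast_vecMul_hatB`). Hence ⟨β| is a pseudo-eigenstate, and its eigenvalue
vanishes at every node η/2 - ξₙ. On a covector killed by `hatB` at x, the reflection equation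
(`U_reflection`) collapses to two-term exchange relations (`vecMul_hatA_hatA`, `vecMul_hatA_hatB`).
Acting with `hatA` at an unused node therefore gives another pseudo-eigenstate, in which only the
zeros attached to that site have moved. Induction over the nodes gives all the states
(`listState_vecMul_hatB`) and their independence of the order (`Generic.listState_perm`).

Since `hatB` sends one family of states to another, independence is not read off from the
eigenvalues but proved by induction on N (`Generic.listState_linearIndependent`). Contracting the
last site with a vector annihilated by its covector kills the states with last label 0. It turns
those with last label 1 into states of the shorter chain, times a pseudo-eigenvalue. The last
assumption of the theorem says exactly that the boundary factors met in this way do not vanish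
(`gaugeFactor_ne_zero`). -/

/-- The six-vertex weight matrix with weights `a`, `b`, `s`. -/
def sixVertex (a b s : ℂ) (i k j l : Fin 2) : ℂ :=
  if i = j ∧ k = l then (if i = k then a else b) else if i = l ∧ k = j then s else 0

theorem rMatrix_apply (η x : ℂ) (i k j l : Fin 2) :
    rMatrix η x (i, k) (j, l) = sixVertex (sinh (x + η)) (sinh x) (sinh η) i k j l := by
  fin_cases i <;> fin_cases k <;> fin_cases j <;> fin_cases l <;>
    simp [rMatrix, finProdFinEquiv, sixVertex]

/-- The `(i, j)` auxiliary block of the `R`-matrix. -/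
def rBlock (η x : ℂ) : Matrix (Fin 2) (Fin 2) (Matrix (Fin 2) (Fin 2) ℂ) :=
  fun i j => Matrix.of fun a b => rMatrix η x (i, a) (j, b)

/-! ### Operators on two auxiliary spaces. -/

section TwoAux

variable {A : Type*} [Ring A]

/-- Action on the first of two auxiliary spaces. -/
def fstAux (X : Matrix (Fin 2) (Fin 2) A) : Matrix (Fin 2 × Fin 2) (Fin 2 × Fin 2) A :=
  fun i j => if i.2 = j.2 then X i.1 j.1 else 0

/-- Action on the second of two auxiliary spaces. -/
def sndAux (X : Matrix (Fin 2) (Fin 2) A) : Matrix (Fin 2 × Fin 2) (Fin 2 × Fin 2) A :=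
  fun i j => if i.1 = j.1 then X i.2 j.2 else 0

/-- The `R`-matrix acting on the two auxiliary spaces. -/
def rAux (A : Type*) [Ring A] [Algebra ℂ A] (η x : ℂ) :
    Matrix (Fin 2 × Fin 2) (Fin 2 × Fin 2) A :=
  (rMatrix η x).map (algebraMap ℂ A)

theorem fstAux_mul (X Y : Matrix (Fin 2) (Fin 2) A) :
    fstAux (X * Y) = fstAux X * fstAux Y := by
  ext ⟨i, j⟩ ⟨k, l⟩
  by_cases h : j = l
  · simp [fstAux, Matrix.mul_apply, Fintype.sum_prod_type, h]
  · simp [fstAux, Matrix.mul_apply, Fintype.sum_prod_type, h]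

theorem sndAux_mul (X Y : Matrix (Fin 2) (Fin 2) A) :
    sndAux (X * Y) = sndAux X * sndAux Y := by
  ext ⟨i, j⟩ ⟨k, l⟩
  by_cases h : i = k
  · simp [sndAux, Matrix.mul_apply, Fintype.sum_prod_type, h]
  · simp [sndAux, Matrix.mul_apply, Fintype.sum_prod_type, h]

theorem fstAux_mul_sndAux_comm {X Y : Matrix (Fin 2) (Fin 2) A}
    (h : ∀ i j k l, X i j * Y k l = Y k l * X i j) :
    fstAux X * sndAux Y = sndAux Y * fstAux X := by
  ext ⟨i, j⟩ ⟨k, l⟩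
  simp [fstAux, sndAux, Matrix.mul_apply, Fintype.sum_prod_type, h]

variable [Algebra ℂ A] {A' : Type*} [Ring A'] [Algebra ℂ A']

theorem fstAux_map (f : A →ₐ[ℂ] A') (X : Matrix (Fin 2) (Fin 2) A) :
    fstAux (X.map f) = (fstAux X).map f := by
  ext ⟨i, j⟩ ⟨k, l⟩
  by_cases h : j = l <;> simp [fstAux, h]

theorem sndAux_map (f : A →ₐ[ℂ] A') (X : Matrix (Fin 2) (Fin 2) A) :
    sndAux (X.map f) = (sndAux X).map f := by
  ext ⟨i, j⟩ ⟨k, l⟩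
  by_cases h : i = k <;> simp [sndAux, h]

theorem rAux_map (f : A →ₐ[ℂ] A') (η x : ℂ) : (rAux A η x).map f = rAux A' η x := by
  ext i j
  simp [rAux]

end TwoAux

/-! ### Yang–Baxter equation and scalar reflection equation. -/

/-- Yang–Baxter equation for six-vertex weights, in RLL form. -/
theorem sixVertex_rll {a b a₁ b₁ a₂ b₂ s : ℂ} (h₁ : a * b₁ = b₂ * s + a₁ * b)
    (h₂ : a * a₂ = b₂ * b + a₁ * s) (h₃ : b₁ * a₂ = s * b + b₂ * a₁) (i j p k l q : Fin 2) :
    ∑ x, ∑ y, ∑ z,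
        sixVertex a b s i j x y * sixVertex a₁ b₁ s x p k z * sixVertex a₂ b₂ s y z l q =
      ∑ x, ∑ y, ∑ z,
        sixVertex a₂ b₂ s j p y x * sixVertex a₁ b₁ s i x z q * sixVertex a b s z y k l := by
  revert i j p k l q
  simp [Fin.forall_fin_two, sixVertex]
  grind

/-- Yang–Baxter equation for six-vertex weights, in the form used for dressing. -/
theorem sixVertex_dressing {a b a₁ b₁ a₂ b₂ s : ℂ} (h₁ : a * b₁ = b₂ * s + a₁ * b)
    (h₂ : a * a₂ = b₂ * b + a₁ * s) (h₃ : b₁ * a₂ = s * b + b₂ * a₁) (i j p k l q : Fin 2) :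
    ∑ x, ∑ y, ∑ z,
        sixVertex a b s i p x z * sixVertex a₁ b₁ s x j k y * sixVertex a₂ b₂ s y z l q =
      ∑ x, ∑ y, ∑ z,
        sixVertex a₂ b₂ s j p y z * sixVertex a₁ b₁ s i y x l * sixVertex a b s x z k q := by
  revert i j p k l q
  simp [Fin.forall_fin_two, sixVertex]
  grind

/-- These are the only relations between the weights that the Yang–Baxter equation needs. The RLL
form uses them at (x, y), the dressing form at (x + y, y). -/
theorem sinh_weights (η x y : ℂ) :
    (sinh (x - y + η) * sinh x = sinh y * sinh η + sinh (x + η) * sinh (x - y)) ∧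
    (sinh (x - y + η) * sinh (y + η) = sinh y * sinh (x - y) + sinh (x + η) * sinh η) ∧
    (sinh x * sinh (y + η) = sinh η * sinh (x - y) + sinh y * sinh (x + η)) := by
  simp only [sinh_add, sinh_sub, cosh_sub]
  refine ⟨?_, ?_, ?_⟩
  · linear_combination (sinh η * sinh y) * cosh_sq x
  · grind [cosh_sq x, cosh_sq y, cosh_sq η]
  · grind [cosh_sq x, cosh_sq y, cosh_sq η]

theorem rBlock_rll (η x y : ℂ) :
    rAux _ η (x - y) * fstAux (rBlock η x) * sndAux (rBlock η y) =
      sndAux (rBlock η y) * fstAux (rBlock η x) * rAux _ η (x - y) := by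
  obtain ⟨h₁, h₂, h₃⟩ := sinh_weights η x y
  ext ⟨i, j⟩ ⟨k, l⟩ p q
  have := sixVertex_rll h₁ h₂ h₃ i j p k l q
  simp [Matrix.mul_apply, Fintype.sum_prod_type, fstAux, sndAux, rAux, rBlock, rMatrix_apply,
      Matrix.algebraMap_matrix_apply] at this ⊢
  linear_combination this

theorem rBlock_dressing (η x y : ℂ) :
    fstAux (rBlock η x) * rAux _ η (x + y) * sndAux (rBlock η y) =
      sndAux (rBlock η y) * rAux _ η (x + y) * fstAux (rBlock η x) := by
  obtain ⟨h₁, h₂, h₃⟩ := sinh_weights η (x + y) y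
  rw [add_sub_cancel_right] at h₁ h₂ h₃
  ext ⟨i, j⟩ ⟨k, l⟩ p q
  have := sixVertex_dressing h₁ h₂ h₃ i j p k l q
  simp [Matrix.mul_apply, Fintype.sum_prod_type, fstAux, sndAux, rAux, rBlock, rMatrix_apply,
      Matrix.algebraMap_matrix_apply] at this ⊢
  linear_combination this

/-- Reflection equation for the scalar reflection matrix. -/
theorem kMatrix_reflection (η ζ κ τ x y : ℂ) :
    rAux ℂ η (x - y) * fstAux (kMatrix η ζ κ τ x) * rAux ℂ η (x + y - η) *
        sndAux (kMatrix η ζ κ τ y) =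
      sndAux (kMatrix η ζ κ τ y) * rAux ℂ η (x + y - η) * fstAux (kMatrix η ζ κ τ x) *
        rAux ℂ η (x - y) := by
  -- Centring the spectral parameters at η/2 removes half-integer shifts; each entry then becomes a
  -- rational identity in exponentials, with the boundary constants left free.
  obtain ⟨X, rfl⟩ : ∃ X, x = X + η / 2 := ⟨x - η / 2, by ring⟩
  obtain ⟨Y, rfl⟩ : ∃ Y, y = Y + η / 2 := ⟨y - η / 2, by ring⟩
  have hK : ∀ Z, kMatrix η ζ κ τ (Z + η / 2) =
      !![1 / sinh ζ * sinh (Z + ζ), 1 / sinh ζ * (κ * exp τ) * sinh (2 * Z);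
         1 / sinh ζ * (κ * exp (-τ)) * sinh (2 * Z), 1 / sinh ζ * sinh (ζ - Z)] := by
    intro Z
    ext i j
    fin_cases i <;> fin_cases j <;> simp [kMatrix, mul_assoc] <;> ring_nf <;> simp
  rw [hK, hK, show X + η / 2 - (Y + η / 2) = X - Y by ring,
    show X + η / 2 + (Y + η / 2) - η = X + Y by ring]
  generalize 1 / sinh ζ * (κ * exp τ) = p
  generalize 1 / sinh ζ * (κ * exp (-τ)) = r
  generalize 1 / sinh ζ = w
  have e1 : ∀ z, sinh z = (exp z - (exp z)⁻¹) / 2 := fun z => by rw [sinh, exp_neg]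
  have e2 : ∀ z, exp (2 * z) = exp z ^ 2 := fun z => by rw [two_mul, exp_add, sq]
  have hX := exp_ne_zero X
  have hY := exp_ne_zero Y
  have hη := exp_ne_zero η
  have hζ := exp_ne_zero ζ
  ext ⟨i, j⟩ ⟨k, l⟩
  fin_cases i <;> fin_cases j <;> fin_cases k <;> fin_cases l <;>
    simp [Matrix.mul_apply, Fintype.sum_prod_type, fstAux, sndAux, rAux, rMatrix_apply,
      sixVertex] <;>
    simp only [e1, exp_add, exp_sub, e2] <;>
    generalize exp X = X' at * <;> generalize exp Y = Y' at * <;>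
    generalize exp η = η' at * <;> generalize exp ζ = ζ' at * <;>
    field_simp <;> ring

/-! ### Splitting off the last site. -/

/-- Sums over configurations of `N + 1` spins, splitting off the last spin. -/
theorem sum_config_succ {M : Type*} [AddCommMonoid M] {N : ℕ} (f : (Fin (N + 1) → Fin 2) → M) :
    ∑ s, f s = ∑ b, ∑ s : Fin N → Fin 2, f (Fin.snoc s b) := by
  rw [← Fintype.sum_prod_type' (f := fun b (s : Fin N → Fin 2) => f (Fin.snoc s b))]
  exact (Equiv.sum_comp (Fin.snocEquiv fun _ : Fin (N + 1) => Fin 2) f).symm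

theorem config_ext {N : ℕ} (s t : Fin (N + 1) → Fin 2) :
    s = t ↔ s (Fin.last N) = t (Fin.last N) ∧ Fin.init s = Fin.init t := by
  constructor
  · rintro rfl
    exact ⟨rfl, rfl⟩
  · rintro ⟨h₁, h₂⟩
    rw [← Fin.snoc_init_self s, ← Fin.snoc_init_self t, h₁, h₂]

/-- The embedding of the operators on the first `N` sites into those on `N + 1` sites. -/
def extendOp (N : ℕ) : Op N →ₐ[ℂ] Op (N + 1) :=
  AlgHom.ofLinearMap
    { toFun := fun X => Matrix.of fun s t =>
        if s (Fin.last N) = t (Fin.last N) then X (Fin.init s) (Fin.init t) else 0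
      map_add' := fun X Y => by
        ext s t
        simp only [Matrix.add_apply, Matrix.of_apply]
        split_ifs <;> simp
      map_smul' := fun r X => by ext s t; simp }
    (by
      ext s t
      change (if s (Fin.last N) = t (Fin.last N) then
        (1 : Op N) (Fin.init s) (Fin.init t) else 0) = _
      simp only [Matrix.one_apply, config_ext s t, ite_and])
    (by
      intro X Y
      ext s t
      rw [Matrix.mul_apply, sum_config_succ, Finset.sum_eq_single (s (Fin.last N))]
      · change (if s (Fin.last N) = t (Fin.last N) then
          (X * Y) (Fin.init s) (Fin.init t) else 0) = _
        simp only [LinearMap.coe_mk, AddHom.coe_mk, Matrix.of_apply, Fin.snoc_last, Fin.init_snoc,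
          Matrix.mul_apply]
        split_ifs <;> simp
      · intro b _ hb
        simp [hb.symm]
      · simp)

theorem extendOp_apply {N : ℕ} (X : Op N) (s t : Fin (N + 1) → Fin 2) :
    extendOp N X s t =
      if s (Fin.last N) = t (Fin.last N) then X (Fin.init s) (Fin.init t) else 0 := rfl

/-- The embedding of the operators on the last site. -/
def lastSite (N : ℕ) : Matrix (Fin 2) (Fin 2) ℂ →ₐ[ℂ] Op (N + 1) :=
  AlgHom.ofLinearMap
    { toFun := fun m => Matrix.of fun s t =>
        if Fin.init s = Fin.init t then m (s (Fin.last N)) (t (Fin.last N)) else 0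
      map_add' := fun X Y => by
        ext s t
        simp only [Matrix.add_apply, Matrix.of_apply]
        split_ifs <;> simp
      map_smul' := fun r X => by ext s t; simp }
    (by
      ext s t
      change (if Fin.init s = Fin.init t then
        (1 : Matrix (Fin 2) (Fin 2) ℂ) (s (Fin.last N)) (t (Fin.last N)) else 0) = _
      simp only [Matrix.one_apply, config_ext s t, ← ite_and, and_comm])
    (by
      intro X Y
      ext s t
      rw [Matrix.mul_apply, sum_config_succ, Finset.sum_comm,
        Finset.sum_eq_single (Fin.init s)]
      · change (if Fin.init s = Fin.init t then
          (X * Y) (s (Fin.last N)) (t (Fin.last N)) else 0) = _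
        simp only [LinearMap.coe_mk, AddHom.coe_mk, Matrix.of_apply, Fin.snoc_last, Fin.init_snoc,
          Matrix.mul_apply]
        split_ifs <;> simp
      · intro b _ hb
        simp [hb.symm]
      · simp)

theorem lastSite_apply {N : ℕ} (m : Matrix (Fin 2) (Fin 2) ℂ) (s t : Fin (N + 1) → Fin 2) :
    lastSite N m s t =
      if Fin.init s = Fin.init t then m (s (Fin.last N)) (t (Fin.last N)) else 0 := rfl

theorem extendOp_mul_lastSite_apply {N : ℕ} (X : Op N) (m : Matrix (Fin 2) (Fin 2) ℂ)
    (s t : Fin (N + 1) → Fin 2) :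
    (extendOp N X * lastSite N m) s t =
      X (Fin.init s) (Fin.init t) * m (s (Fin.last N)) (t (Fin.last N)) := by
  rw [Matrix.mul_apply, sum_config_succ, Finset.sum_eq_single (s (Fin.last N)),
    Finset.sum_eq_single (Fin.init t)]
  · simp [extendOp_apply, lastSite_apply]
  · intro u _ hu
    simp [lastSite_apply, hu]
  · simp
  · intro b _ hb
    simp [extendOp_apply, hb.symm]
  · simp

theorem lastSite_mul_extendOp {N : ℕ} (X : Op N) (m : Matrix (Fin 2) (Fin 2) ℂ) :
    lastSite N m * extendOp N X = extendOp N X * lastSite N m := by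
  ext s t
  rw [extendOp_mul_lastSite_apply]
  rw [Matrix.mul_apply, sum_config_succ, Finset.sum_eq_single (t (Fin.last N)),
    Finset.sum_eq_single (Fin.init s)]
  · simp [extendOp_apply, lastSite_apply, mul_comm]
  · intro u _ hu
    simp [lastSite_apply, hu.symm]
  · simp
  · intro b _ hb
    simp [extendOp_apply, hb]
  · simp

theorem site_last {N : ℕ} (m : Matrix (Fin 2) (Fin 2) ℂ) :
    site (Fin.last N) m = lastSite N m := by
  ext s t
  rw [lastSite_apply, site]
  congr 1
  simp only [Fin.forall_fin_succ', ne_eq, not_true_eq_false, IsEmpty.forall_iff, and_true,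
    funext_iff, Fin.init, eq_iff_iff]
  exact forall_congr' fun k => by simp [Fin.castSucc_ne_last]

theorem site_castSucc {N : ℕ} (n : Fin N) (m : Matrix (Fin 2) (Fin 2) ℂ) :
    site n.castSucc m = extendOp N (site n m) := by
  ext s t
  rw [extendOp_apply, site, site, ← ite_and]
  congr 1
  simp only [Fin.forall_fin_succ', ne_eq, Fin.init, eq_iff_iff, Fin.castSucc_inj]
  have : ¬ Fin.last N = n.castSucc := (Fin.castSucc_ne_last n).symm
  simp [this, and_comm]

/-- The tensor product of a covector on the first `N` sites and one on the last site. -/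
def tensorLast {N : ℕ} (φ : (Fin N → Fin 2) → ℂ) (v : Fin 2 → ℂ) : (Fin (N + 1) → Fin 2) → ℂ :=
  fun s => φ (Fin.init s) * v (s (Fin.last N))

theorem tensorLast_vecMul {N : ℕ} (φ : (Fin N → Fin 2) → ℂ) (v : Fin 2 → ℂ) (X : Op N)
    (m : Matrix (Fin 2) (Fin 2) ℂ) :
    Matrix.vecMul (tensorLast φ v) (extendOp N X * lastSite N m) =
      tensorLast (Matrix.vecMul φ X) (Matrix.vecMul v m) := by
  ext t
  simp only [Matrix.vecMul, dotProduct, extendOp_mul_lastSite_apply, sum_config_succ, tensorLast,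
    Fin.init_snoc, Fin.snoc_last]
  rw [Finset.sum_mul_sum, Finset.sum_comm]
  exact Finset.sum_congr rfl fun _ _ => Finset.sum_congr rfl fun _ _ => by ring

/-! ### Recursion for the monodromy matrices and reflection equation. -/

namespace Chain

/-- The chain without its last site. -/
def init {N : ℕ} (c : Chain (N + 1)) : Chain N :=
  { c with ξ := fun n => c.ξ n.castSucc }

variable {N : ℕ}

theorem R0_castSucc (c : Chain (N + 1)) (n : Fin N) (x : ℂ) :
    c.R0 n.castSucc x = (c.init.R0 n x).map (extendOp N) := by
  ext1 i j
  exact site_castSucc n _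

theorem R0_last (c : Chain (N + 1)) (x : ℂ) :
    c.R0 (Fin.last N) x = (rBlock c.η x).map (lastSite N) := by
  ext1 i j
  exact site_last _

theorem M_succ (c : Chain (N + 1)) (x : ℂ) :
    c.M x = (rBlock c.η (x - c.ξ (Fin.last N) - c.η / 2)).map (lastSite N) *
      (c.init.M x).map (extendOp N) := by
  have : (c.init.M x).map (extendOp N) = (extendOp N).mapMatrix (c.init.M x) := rfl
  rw [this, M, M, map_list_prod, List.finRange_succ_last, List.reverse_append, List.map_append,
    List.prod_append]
  simp only [List.reverse_cons, List.reverse_nil, List.nil_append, List.map_cons, List.map_nil,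
    List.prod_cons, List.prod_nil, mul_one, R0_last, ← List.map_reverse, List.map_map]
  congr 2
  refine List.map_congr_left fun n _ => ?_
  exact R0_castSucc c n _

theorem pauliY_conj_transpose (X : AuxOp N) :
    aux N pauliY * X.transpose * aux N pauliY = !![X 1 1, - X 0 1; - X 1 0, X 0 0] := by
  ext1 i j
  fin_cases i <;> fin_cases j <;>
    simp [Matrix.mul_apply, aux, pauliY, smul_smul]

theorem Mhat_eq (c : Chain N) (x : ℂ) :
    c.Mhat x = (-1 : ℂ) ^ N • !![c.M (-x) 1 1, - c.M (-x) 0 1; - c.M (-x) 1 0, c.M (-x) 0 0] := by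
  rw [Mhat, pauliY_conj_transpose]

/-- Crossing symmetry: conjugating the partial transpose of R(-x-η) by σ^y gives -R(x). The sign,
one per site, is what (-1)^N in M̂ compensates. -/
theorem rBlock_crossing (η x : ℂ) :
    rBlock η x = !![-rBlock η (-x - η) 1 1, rBlock η (-x - η) 0 1;
      rBlock η (-x - η) 1 0, -rBlock η (-x - η) 0 0] := by
  have h₁ : sinh (-x - η) = - sinh (x + η) := by rw [← sinh_neg]; ring_nf
  ext i j a b
  fin_cases i <;> fin_cases j <;> fin_cases a <;> fin_cases b <;>
    simp [rBlock, rMatrix_apply, sixVertex, h₁]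

theorem Mhat_succ (c : Chain (N + 1)) (x : ℂ) :
    c.Mhat x = (c.init.Mhat x).map (extendOp N) *
      (rBlock c.η (x + c.ξ (Fin.last N) - c.η / 2)).map (lastSite N) := by
  rw [Mhat_eq, Mhat_eq, M_succ, rBlock_crossing c.η (x + c.ξ (Fin.last N) - c.η / 2),
    show -(x + c.ξ (Fin.last N) - c.η / 2) - c.η = -x - c.ξ (Fin.last N) - c.η / 2 by ring]
  ext1 i j
  fin_cases i <;> fin_cases j <;>
    simp [Matrix.mul_apply, lastSite_mul_extendOp, pow_succ] <;> abel

theorem U_succ (c : Chain (N + 1)) (x : ℂ) :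
    c.U x = (rBlock c.η (x - c.ξ (Fin.last N) - c.η / 2)).map (lastSite N) *
      (c.init.U x).map (extendOp N) *
      (rBlock c.η (x + c.ξ (Fin.last N) - c.η / 2)).map (lastSite N) := by
  have h : aux (N + 1) (kMatrix c.η c.ζ c.κ c.τ x) =
      (aux N (kMatrix c.η c.ζ c.κ c.τ x)).map (extendOp N) := by
    ext1 i j
    simp [aux]
  rw [U, M_succ, Mhat_succ, U, Matrix.map_mul, Matrix.map_mul, h]
  simp only [mul_assoc]
  rfl

theorem U_zero (c : Chain 0) (x : ℂ) :
    c.U x = (kMatrix c.η c.ζ c.κ c.τ x).map (algebraMap ℂ (Op 0)) := by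
  have h : c.M = fun _ => 1 := by ext1 y; simp [M]
  rw [U, Mhat_eq, h]
  ext1 i j
  fin_cases i <;> fin_cases j <;>
    simp [Matrix.mul_apply, aux, Algebra.algebraMap_eq_smul_one]

/-- Reflection equation for the boundary monodromy matrix. -/
theorem U_reflection (c : Chain N) (x y : ℂ) :
    rAux _ c.η (x - y) * fstAux (c.U x) * rAux _ c.η (x + y - c.η) * sndAux (c.U y) =
      sndAux (c.U y) * rAux _ c.η (x + y - c.η) * fstAux (c.U x) * rAux _ c.η (x - y) := by
  induction N with
  | zero =>
    have h := congrArg (fun X => X.map (Algebra.ofId ℂ (Op 0)))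
      (kMatrix_reflection c.η c.ζ c.κ c.τ x y)
    simp only [Matrix.map_mul, rAux_map, ← fstAux_map, ← sndAux_map] at h
    rw [U_zero, U_zero]
    exact h
  | succ N ih =>
    rw [U_succ, U_succ]
    set ξ := c.ξ (Fin.last N)
    have ih := congrArg (fun X => X.map (extendOp N)) (ih c.init)
    simp only [Matrix.map_mul, rAux_map, ← fstAux_map, ← sndAux_map] at ih
    have rll := fun u v => congrArg (fun X => X.map (lastSite N)) (rBlock_rll c.η u v)
    have drs := fun u v => congrArg (fun X => X.map (lastSite N)) (rBlock_dressing c.η u v)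
    simp only [Matrix.map_mul, rAux_map, ← fstAux_map, ← sndAux_map] at rll drs
    have comm : ∀ (X : AuxOp N) u, fstAux (X.map (extendOp N)) *
        sndAux ((rBlock c.η u).map (lastSite N)) =
        sndAux ((rBlock c.η u).map (lastSite N)) * fstAux (X.map (extendOp N)) := fun X u =>
      fstAux_mul_sndAux_comm fun i j k l => by simp [lastSite_mul_extendOp]
    have comm' : ∀ (X : AuxOp N) u, sndAux (X.map (extendOp N)) *
        fstAux ((rBlock c.η u).map (lastSite N)) =
        fstAux ((rBlock c.η u).map (lastSite N)) * sndAux (X.map (extendOp N)) := fun X u =>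
      (fstAux_mul_sndAux_comm fun i j k l => by simp [lastSite_mul_extendOp]).symm
    simp only [fstAux_mul, sndAux_mul]
    -- The inhomogeneity cancels in differences for equal signs of ξ and in sums for opposite signs,
    -- leaving the same two matrices R(x-y) and R(x+y-η) at every site.
    have r₁ := rll (x - ξ - c.η / 2) (y - ξ - c.η / 2)
    have r₂ := rll (x + ξ - c.η / 2) (y + ξ - c.η / 2)
    have d₁ := drs (x + ξ - c.η / 2) (y - ξ - c.η / 2)
    have d₂ := drs (x - ξ - c.η / 2) (y + ξ - c.η / 2)
    rw [show x - ξ - c.η / 2 - (y - ξ - c.η / 2) = x - y by ring] at r₁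
    rw [show x + ξ - c.η / 2 - (y + ξ - c.η / 2) = x - y by ring] at r₂
    rw [show x + ξ - c.η / 2 + (y - ξ - c.η / 2) = x + y - c.η by ring] at d₁
    rw [show x - ξ - c.η / 2 + (y + ξ - c.η / 2) = x + y - c.η by ring] at d₂
    have c₁ := comm (c.init.U x) (y - ξ - c.η / 2)
    have c₂ := comm (c.init.U x) (y + ξ - c.η / 2)
    have c₃ := comm' (c.init.U y) (x - ξ - c.η / 2)
    have c₄ := comm' (c.init.U y) (x + ξ - c.η / 2)
    change rAux _ c.η (x - y) * _ * rAux _ c.η (x + y - c.η) * _ =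
      _ * rAux _ c.η (x + y - c.η) * _ * rAux _ c.η (x - y) at ih
    generalize fstAux ((rBlock c.η (x - ξ - c.η / 2)).map (lastSite N)) = L₁ at *
    generalize fstAux ((rBlock c.η (x + ξ - c.η / 2)).map (lastSite N)) = L₁' at *
    generalize sndAux ((rBlock c.η (y - ξ - c.η / 2)).map (lastSite N)) = L₂ at *
    generalize sndAux ((rBlock c.η (y + ξ - c.η / 2)).map (lastSite N)) = L₂' at *
    generalize fstAux ((c.init.U x).map (extendOp N)) = U₁ at *
    generalize sndAux ((c.init.U y).map (extendOp N)) = U₂ at *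
    generalize rAux (Op (N + 1)) c.η (x - y) = r at *
    generalize rAux (Op (N + 1)) c.η (x + y - c.η) = r' at *
    -- Dressing: the last-site factors commute with the shorter chain, so they can be moved through
    -- r and r' until the inductive reflection equation stands alone in the middle.
    calc r * (L₁ * U₁ * L₁') * r' * (L₂ * U₂ * L₂')
        = r * L₁ * U₁ * (L₁' * r' * L₂) * U₂ * L₂' := by noncomm_ring
      _ = r * L₁ * (U₁ * L₂) * r' * (L₁' * U₂) * L₂' := by rw [d₁]; noncomm_ring
      _ = (r * L₁ * L₂) * U₁ * r' * U₂ * L₁' * L₂' := by rw [c₁, ← c₄]; noncomm_ring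
      _ = L₂ * L₁ * (r * U₁ * r' * U₂) * L₁' * L₂' := by rw [r₁]; noncomm_ring
      _ = L₂ * L₁ * U₂ * r' * U₁ * (r * L₁' * L₂') := by rw [ih]; noncomm_ring
      _ = L₂ * (L₁ * U₂) * r' * (U₁ * L₂') * L₁' * r := by rw [r₂]; noncomm_ring
      _ = L₂ * U₂ * (L₁ * r' * L₂') * U₁ * L₁' * r := by rw [c₂, ← c₃]; noncomm_ring
      _ = L₂ * U₂ * L₂' * r' * (L₁ * U₁ * L₁') * r := by rw [d₂]; noncomm_ring

end Chain

/-! ### Exchange relations on covectors annihilated by `hatB`. -/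

/-- Contraction of the reflection equation, written for the scalars `F i j k l` and `G k l i j`
which replace the products of entries `U(x)ᵢⱼ U(y)ₖₗ` and `U(y)ₖₗ U(x)ᵢⱼ`. -/
def ReflectionRel (η x y : ℂ) (F G : Fin 2 → Fin 2 → Fin 2 → Fin 2 → ℂ) : Prop :=
  ∀ i₁ i₂ j₁ j₂,
    ∑ k₁, ∑ k₂, ∑ l₁, ∑ m₂, sixVertex (sinh (x - y + η)) (sinh (x - y)) (sinh η) i₁ i₂ k₁ k₂ *
        sixVertex (sinh (x + y)) (sinh (x + y - η)) (sinh η) l₁ k₂ j₁ m₂ * F k₁ l₁ m₂ j₂ =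
      ∑ k₁, ∑ k₂, ∑ l₁, ∑ l₂, sixVertex (sinh (x + y)) (sinh (x + y - η)) (sinh η) i₁ k₂ k₁ l₂ *
        sixVertex (sinh (x - y + η)) (sinh (x - y)) (sinh η) l₁ l₂ j₁ j₂ * G i₂ k₂ k₁ l₁

/-- The hypotheses say that φ·`hatB`(x)·U(y)₁₀ and φ·`hatB`(y)·U(x)₁₀ vanish; these are the only
unwanted terms in the exchange of two `hatA`. -/
theorem ReflectionRel.A_A {η x y T : ℂ} {F G : Fin 2 → Fin 2 → Fin 2 → Fin 2 → ℂ}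
    (h : ReflectionRel η x y F G)
    (hx : F 0 1 1 0 + T * exp (x - η / 2) * F 0 0 1 0 - T * exp (-x + η / 2) * F 1 1 1 0 -
      T ^ 2 * F 1 0 1 0 = 0)
    (hy : G 0 1 1 0 + T * exp (y - η / 2) * G 0 0 1 0 - T * exp (-y + η / 2) * G 1 1 1 0 -
      T ^ 2 * G 1 0 1 0 = 0) :
    sinh (x - y + η) * sinh (x + y) *
        (F 0 0 0 0 - T * exp (-x + η / 2) * F 1 0 0 0 - T * exp (-y + η / 2) *
          (F 0 0 1 0 - T * exp (-x + η / 2) * F 1 0 1 0)) =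
      sinh (x - y + η) * sinh (x + y) *
        (G 0 0 0 0 - T * exp (-y + η / 2) * G 1 0 0 0 - T * exp (-x + η / 2) *
          (G 0 0 1 0 - T * exp (-y + η / 2) * G 1 0 1 0)) := by
  have h00 := h 0 0 0 0
  have h01 := h 0 1 0 0
  have h10 := h 1 0 0 0
  have h11 := h 1 1 0 0
  simp only [Fin.sum_univ_two, sixVertex] at h00 h01 h10 h11
  simp at h00 h01 h10 h11
  obtain ⟨θ, rfl⟩ : ∃ θ, η = 2 * θ := ⟨η / 2, by ring⟩
  have e1 : ∀ z, sinh z = (exp z - (exp z)⁻¹) / 2 := fun z => by rw [sinh, exp_neg]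
  have e2 : ∀ z, exp (2 * z) = exp z ^ 2 := fun z => by rw [two_mul, exp_add, sq]
  simp only [e1, exp_add, exp_sub, exp_neg, e2, mul_div_cancel_left₀ θ two_ne_zero] at *
  have h1 := exp_ne_zero x
  have h2 := exp_ne_zero y
  have h3 := exp_ne_zero θ
  generalize exp x = p at *
  generalize exp y = m at *
  generalize exp θ = q at *
  -- The left indices are contracted with (1, -T e^{-x-η/2}) ⊗ (1, -T e^{-y+η/2}). R(x-y) sends this
  -- row to sinh(x-y+η) times the same row with the shifts ±η/2 exchanged.
  linear_combination (norm := skip) h00 - T * m⁻¹ * q * h01 - T * p⁻¹ * q⁻¹ * h10 +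
    T * m⁻¹ * q * (T * p⁻¹ * q⁻¹) * h11
    - (p / m * q^2 - (p / m * q^2)⁻¹) / 2 * ((q^2-(q^2)⁻¹)/2) * hx
    + (p / m * q^2 - (p / m * q^2)⁻¹) / 2 * ((q^2-(q^2)⁻¹)/2) * hy
  field_simp
  ring

theorem ReflectionRel.A_B {η x y T : ℂ} {F G : Fin 2 → Fin 2 → Fin 2 → Fin 2 → ℂ}
    (h : ReflectionRel η x y F G)
    (hx : ∀ k l, F 0 1 k l + T * exp (x - η / 2) * F 0 0 k l - T * exp (-x + η / 2) * F 1 1 k l -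
      T ^ 2 * F 1 0 k l = 0) :
    sinh (x - y + η) * (sinh (x + y) * sinh (y - x) *
        ((F 0 0 0 1 - T * exp (-x + η / 2) * F 1 0 0 1) +
          T * exp (y - η / 2) * (F 0 0 0 0 - T * exp (-x + η / 2) * F 1 0 0 0) -
          T * exp (-y + η / 2) * (F 0 0 1 1 - T * exp (-x + η / 2) * F 1 0 1 1) -
          T ^ 2 * (F 0 0 1 0 - T * exp (-x + η / 2) * F 1 0 1 0))) =
      sinh (x - y + η) * (sinh (x + y - η) * sinh (y - x + η) *
        ((G 0 1 0 0 + T * exp (y - η / 2) * G 0 0 0 0 - T * exp (-y + η / 2) * G 1 1 0 0 -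
          T ^ 2 * G 1 0 0 0) - T * exp (-(2 * η)) * exp (-x + η / 2) *
          (G 0 1 1 0 + T * exp (y - η / 2) * G 0 0 1 0 - T * exp (-y + η / 2) * G 1 1 1 0 -
          T ^ 2 * G 1 0 1 0))) := by
  have h00 := h 0 0 0 0
  have h01 := h 0 1 0 0
  have h10 := h 1 0 0 0
  have h11 := h 1 1 0 0
  have g00 := h 0 0 0 1
  have g01 := h 0 1 0 1
  have g10 := h 1 0 0 1
  have g11 := h 1 1 0 1
  have k00 := h 0 0 1 0
  have k01 := h 0 1 1 0
  have k10 := h 1 0 1 0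
  have k11 := h 1 1 1 0
  have H00 := hx 0 0
  have H01 := hx 0 1
  have H10 := hx 1 0
  have H11 := hx 1 1
  clear h hx
  simp only [Fin.sum_univ_two, sixVertex] at h00 h01 h10 h11 g00 g01 g10 g11 k00 k01 k10 k11
  simp at h00 h01 h10 h11 g00 g01 g10 g11 k00 k01 k10 k11
  obtain ⟨θ, rfl⟩ : ∃ θ, η = 2 * θ := ⟨η / 2, by ring⟩
  have e1 : ∀ z, sinh z = (exp z - (exp z)⁻¹) / 2 := fun z => by rw [sinh, exp_neg]
  have e2 : ∀ z, exp (2 * z) = exp z ^ 2 := fun z => by rw [two_mul, exp_add, sq]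
  simp only [e1, exp_add, exp_sub, exp_neg, e2, mul_div_cancel_left₀ θ two_ne_zero] at *
  have h1 := exp_ne_zero x
  have h2 := exp_ne_zero y
  have h3 := exp_ne_zero θ
  generalize exp x = p at *
  generalize exp y = m at *
  generalize exp θ = q at *
  obtain ⟨a, ha⟩ : ∃ a, a = (p / m * q^2 - (p / m * q^2)⁻¹) / 2 := ⟨_, rfl⟩
  obtain ⟨s, hs⟩ : ∃ s, s = (q^2-(q^2)⁻¹)/2 := ⟨_, rfl⟩
  obtain ⟨w, hw⟩ : ∃ w, w = (p * m / q^2-(p * m / q^2)⁻¹)/2 := ⟨_, rfl⟩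
  -- The coefficients z0, z1, s are the components of R(y-x) applied to (1, 0) ⊗ (T e^{y-3η/2}, 1).
  -- By unitarity this cancels R(x-y) on the right-hand side; the left indices are contracted as in
  -- the `hatA`–`hatA` relation.
  obtain ⟨z0, hz0⟩ : ∃ z, z = (m / p * q^2 - (m / p * q^2)⁻¹) / 2 * (T * m / q ^ 3) := ⟨_, rfl⟩
  obtain ⟨z1, hz1⟩ : ∃ z, z = (m / p - (m / p)⁻¹) / 2 := ⟨_, rfl⟩
  linear_combination (norm := skip)
    z0 * (h00 - T * m⁻¹ * q * h01 - T * p⁻¹ * q⁻¹ * h10 +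
      T * m⁻¹ * q * (T * p⁻¹ * q⁻¹) * h11) +
    z1 * (g00 - T * m⁻¹ * q * g01 - T * p⁻¹ * q⁻¹ * g10 +
      T * m⁻¹ * q * (T * p⁻¹ * q⁻¹) * g11) +
    s * (k00 - T * m⁻¹ * q * k01 - T * p⁻¹ * q⁻¹ * k10 +
      T * m⁻¹ * q * (T * p⁻¹ * q⁻¹) * k11)
    - a * w * s * H00 - a * (s * z0 - T * m⁻¹ * q⁻¹ * ((p * m - (p * m)⁻¹) / 2) * s) * H10
    - a * s * z1 * H11
  subst ha hs hw hz0 hz1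
  field_simp
  ring

namespace Chain

variable {N : ℕ} (c : Chain N)

/-- The entry `(0, 0)` of the boundary monodromy matrix in the unipotent gauge with parameter `T`. -/
def hatA (T x : ℂ) : Op N := c.U x 0 0 - (T * exp (-x + c.η / 2)) • c.U x 1 0

/-- The entry `(0, 1)` of the boundary monodromy matrix in the unipotent gauge with parameter `T`. -/
def hatB (T x : ℂ) : Op N :=
  c.U x 0 1 + (T * exp (x - c.η / 2)) • c.U x 0 0 - (T * exp (-x + c.η / 2)) • c.U x 1 1 -
    (T ^ 2) • c.U x 1 0

/-- Pairing with φ and a configuration s replaces the noncommuting products by independent scalars,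
so that the exchange relations become commutative algebra. -/
theorem reflectionRel (φ : (Fin N → Fin 2) → ℂ) (x y : ℂ) (s : Fin N → Fin 2) :
    ReflectionRel c.η x y
      (fun i j k l => Matrix.vecMul φ (c.U x i j * c.U y k l) s)
      (fun k l i j => Matrix.vecMul φ (c.U y k l * c.U x i j) s) := by
  intro i₁ i₂ j₁ j₂
  have h := congrArg (fun X => Matrix.vecMul φ (X (i₁, i₂) (j₁, j₂)) s) (c.U_reflection x y)
  simp only [Matrix.mul_apply, Fintype.sum_prod_type, fstAux, sndAux, rAux, Matrix.map_apply,
    rMatrix_apply, Algebra.algebraMap_eq_smul_one, mul_ite, ite_mul, mul_zero, zero_mul,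
    Finset.sum_ite_eq', Finset.mem_univ, if_true, Finset.sum_mul,
    Matrix.vecMul_sum, Finset.sum_apply, smul_mul_assoc, mul_smul_comm, one_mul, mul_one,
    Matrix.vecMul_smul, Pi.smul_apply, smul_eq_mul, sub_add_cancel] at h
  fin_cases i₁ <;> fin_cases j₁ <;> simp [Fin.sum_univ_two, Matrix.vecMul_add, Matrix.vecMul_smul] at h ⊢ <;>
    linear_combination h

theorem vecMul_hatA_hatA {φ : (Fin N → Fin 2) → ℂ} {T x y : ℂ}
    (hx : Matrix.vecMul φ (c.hatB T x) = 0) (hy : Matrix.vecMul φ (c.hatB T y) = 0)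
    (h : sinh (x - y + c.η) ≠ 0) (h' : sinh (x + y) ≠ 0) :
    Matrix.vecMul (Matrix.vecMul φ (c.hatA T x)) (c.hatA T y) =
      Matrix.vecMul (Matrix.vecMul φ (c.hatA T y)) (c.hatA T x) := by
  ext s
  have hx' := congrFun (congrArg (fun ψ => Matrix.vecMul ψ (c.U y 1 0)) hx) s
  have hy' := congrFun (congrArg (fun ψ => Matrix.vecMul ψ (c.U x 1 0)) hy) s
  have key := (c.reflectionRel φ x y s).A_A (T := T)
    (by simpa [hatB, Matrix.vecMul_vecMul, Matrix.vecMul_add,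
      Matrix.vecMul_sub, Matrix.vecMul_smul, Matrix.add_vecMul, Matrix.sub_vecMul,
      Matrix.smul_vecMul] using hx')
    (by simpa [hatB, Matrix.vecMul_vecMul, Matrix.vecMul_add,
      Matrix.vecMul_sub, Matrix.vecMul_smul, Matrix.add_vecMul, Matrix.sub_vecMul,
      Matrix.smul_vecMul] using hy')
  have key := mul_left_cancel₀ (mul_ne_zero h h') key
  simp [hatA, Matrix.vecMul_vecMul, Matrix.vecMul_sub, Matrix.vecMul_smul, Matrix.sub_vecMul,
    Matrix.smul_vecMul]
  linear_combination key

theorem vecMul_hatA_hatB {φ : (Fin N → Fin 2) → ℂ} {T x y : ℂ}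
    (hx : Matrix.vecMul φ (c.hatB T x) = 0) (h : sinh (x - y + c.η) ≠ 0) :
    (sinh (x + y) * sinh (y - x)) •
      Matrix.vecMul (Matrix.vecMul φ (c.hatA T x)) (c.hatB T y) =
    (sinh (x + y - c.η) * sinh (y - x + c.η)) •
      Matrix.vecMul (Matrix.vecMul φ (c.hatB T y)) (c.hatA (T * exp (-(2 * c.η))) x) := by
  ext s
  have key := (c.reflectionRel φ x y s).A_B (T := T) (fun k l => by
    have hx' := congrFun (congrArg (fun ψ => Matrix.vecMul ψ (c.U y k l)) hx) s
    simpa [hatB, Matrix.vecMul_vecMul, Matrix.vecMul_add,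
      Matrix.vecMul_sub, Matrix.vecMul_smul, Matrix.add_vecMul, Matrix.sub_vecMul,
      Matrix.smul_vecMul] using hx')
  have key := mul_left_cancel₀ h key
  simp [hatA, hatB, Matrix.vecMul_vecMul, Matrix.vecMul_sub, Matrix.vecMul_smul, Matrix.vecMul_add,
    Matrix.add_vecMul, Matrix.sub_vecMul, Matrix.smul_vecMul]
  linear_combination key

end Chain

/-! ### Action on tensor product covectors. -/

/-- The local covector of the left reference state. -/
def leftCovector (η ξ T : ℂ) : Fin 2 → ℂ := ![-1, T * exp (η - ξ)]

namespace Chain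

variable {N : ℕ}

theorem tensorLast_vecMul_U (c : Chain (N + 1)) (φ : (Fin N → Fin 2) → ℂ) (v : Fin 2 → ℂ)
    (x : ℂ) (i j : Fin 2) (s : Fin (N + 1) → Fin 2) :
    Matrix.vecMul (tensorLast φ v) (c.U x i j) s = ∑ k, ∑ l,
      Matrix.vecMul φ (c.init.U x k l) (Fin.init s) *
        Matrix.vecMul v (rBlock c.η (x - c.ξ (Fin.last N) - c.η / 2) i k *
          rBlock c.η (x + c.ξ (Fin.last N) - c.η / 2) l j) (s (Fin.last N)) := by
  have h : c.U x i j = ∑ k, ∑ l, extendOp N (c.init.U x k l) *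
      lastSite N (rBlock c.η (x - c.ξ (Fin.last N) - c.η / 2) i k *
          rBlock c.η (x + c.ξ (Fin.last N) - c.η / 2) l j) := by
    rw [U_succ, Finset.sum_comm]
    simp only [Matrix.mul_apply, Matrix.map_apply, Finset.sum_mul, lastSite_mul_extendOp, map_mul,
      mul_assoc]
  rw [h]
  simp only [Matrix.vecMul_sum, Finset.sum_apply, tensorLast_vecMul]
  rfl

/-- The gauge row and the local covector form an intertwining pair for R(x-ξ-η/2), which passes them
on with the scalar sinh(x-ξ+η/2) and gauge T e^η for the rest of the chain. The second R-matrix acts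
likewise on the gauge column, so `hatB` meets only `hatB` of the shorter chain. -/
theorem tensorLast_vecMul_hatB (c : Chain (N + 1)) (φ : (Fin N → Fin 2) → ℂ) (T x : ℂ) :
    Matrix.vecMul (tensorLast φ (leftCovector c.η (c.ξ (Fin.last N)) T)) (c.hatB T x) =
      (sinh (x - c.ξ (Fin.last N) + c.η / 2) * sinh (x + c.ξ (Fin.last N) - c.η / 2)) •
        tensorLast (Matrix.vecMul φ (c.init.hatB (T * exp c.η) x))
          (leftCovector c.η (c.ξ (Fin.last N)) (T * exp (-(2 * c.η)))) := by
  ext s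
  have hη : c.init.η = c.η := rfl
  simp only [hatB, Matrix.vecMul_add, Matrix.vecMul_sub, Matrix.vecMul_smul, Pi.add_apply,
    Pi.sub_apply, Pi.smul_apply, smul_eq_mul, tensorLast_vecMul_U, tensorLast, hη,
    Fin.sum_univ_two]
  generalize c.ξ (Fin.last N) = ξ
  generalize s (Fin.last N) = b
  -- The identity is linear in the four entries of the shorter chain, so they may be treated as free
  -- scalars.
  generalize (Matrix.vecMul φ (c.init.U x 0 0) (Fin.init s)) = P
  generalize (Matrix.vecMul φ (c.init.U x 0 1) (Fin.init s)) = Q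
  generalize (Matrix.vecMul φ (c.init.U x 1 0) (Fin.init s)) = R
  generalize (Matrix.vecMul φ (c.init.U x 1 1) (Fin.init s)) = S
  obtain ⟨θ, hθ⟩ : ∃ θ, c.η = 2 * θ := ⟨c.η / 2, by ring⟩
  rw [hθ]
  have e1 : ∀ z, sinh z = (exp z - (exp z)⁻¹) / 2 := fun z => by rw [sinh, exp_neg]
  have e2 : ∀ z, exp (2 * z) = exp z ^ 2 := fun z => by rw [two_mul, exp_add, sq]
  have h1 := exp_ne_zero x
  have h2 := exp_ne_zero ξ
  have h3 := exp_ne_zero θ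
  fin_cases b <;>
    simp [Matrix.vecMul, dotProduct, Matrix.mul_apply, Fin.sum_univ_two, rBlock, rMatrix_apply,
      sixVertex, leftCovector] <;>
    simp only [e1, exp_add, exp_sub, exp_neg, e2] <;>
    generalize exp x = p at * <;> generalize exp ξ = m at * <;> generalize exp θ = q at * <;>
    field_simp <;> ring

/-- The column (1, 0) is not the intertwining one, hence the remainder. It contains only `hatB` of
the shorter chain: it vanishes at unused nodes of that chain, and at the node of the last site it is
what makes the new state independent of the others. -/
theorem tensorLast_vecMul_hatA (c : Chain (N + 1)) (φ : (Fin N → Fin 2) → ℂ) (T x : ℂ) :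
    Matrix.vecMul (tensorLast φ (leftCovector c.η (c.ξ (Fin.last N)) T)) (c.hatA T x) =
      sinh (x - c.ξ (Fin.last N) + c.η / 2) • (sinh (x + c.ξ (Fin.last N) + c.η / 2) •
        tensorLast (Matrix.vecMul φ (c.init.hatA (T * exp c.η) x))
          (leftCovector c.η (c.ξ (Fin.last N)) T) +
        tensorLast (Matrix.vecMul φ (c.init.hatB (T * exp c.η) x)) ![0, - sinh c.η]) := by
  ext s
  have hη : c.init.η = c.η := rfl
  simp only [hatA, hatB, Matrix.vecMul_add, Matrix.vecMul_sub, Matrix.vecMul_smul, Pi.add_apply,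
    Pi.sub_apply, Pi.smul_apply, smul_eq_mul, tensorLast_vecMul_U, tensorLast, hη,
    Fin.sum_univ_two]
  generalize c.ξ (Fin.last N) = ξ
  generalize s (Fin.last N) = b
  generalize (Matrix.vecMul φ (c.init.U x 0 0) (Fin.init s)) = P
  generalize (Matrix.vecMul φ (c.init.U x 0 1) (Fin.init s)) = Q
  generalize (Matrix.vecMul φ (c.init.U x 1 0) (Fin.init s)) = R
  generalize (Matrix.vecMul φ (c.init.U x 1 1) (Fin.init s)) = S
  obtain ⟨θ, hθ⟩ : ∃ θ, c.η = 2 * θ := ⟨c.η / 2, by ring⟩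
  rw [hθ]
  have e1 : ∀ z, sinh z = (exp z - (exp z)⁻¹) / 2 := fun z => by rw [sinh, exp_neg]
  have e2 : ∀ z, exp (2 * z) = exp z ^ 2 := fun z => by rw [two_mul, exp_add, sq]
  have h1 := exp_ne_zero x
  have h2 := exp_ne_zero ξ
  have h3 := exp_ne_zero θ
  fin_cases b <;>
    simp [Matrix.vecMul, dotProduct, Matrix.mul_apply, Fin.sum_univ_two, rBlock, rMatrix_apply,
      sixVertex, leftCovector] <;>
    simp only [e1, exp_add, exp_sub, exp_neg, e2] <;>
    generalize exp x = p at * <;> generalize exp ξ = m at * <;> generalize exp θ = q at * <;>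
    field_simp <;> ring

/-- The factor of the pseudo-eigenvalues which comes from the boundary matrix. -/
def boundaryFactor (c : Chain N) (T x : ℂ) : ℂ :=
  sinh (2 * x - c.η) / sinh c.ζ *
    (c.κ * (exp c.τ - T ^ 2 * exp (-c.τ)) + T * exp c.ζ)

theorem hatB_zero (c : Chain 0) (T x : ℂ) : c.hatB T x = c.boundaryFactor T x • 1 := by
  obtain ⟨X, rfl⟩ : ∃ X, x = X + c.η / 2 := ⟨x - c.η / 2, by ring⟩
  simp only [hatB, U_zero, Matrix.map_apply, Algebra.algebraMap_eq_smul_one, smul_smul,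
    ← add_smul, ← sub_smul, boundaryFactor]
  congr 1
  simp only [kMatrix, Matrix.smul_apply, Matrix.of_apply, Matrix.cons_val', Matrix.cons_val_zero,
    Matrix.cons_val_one, Matrix.cons_val_fin_one, smul_eq_mul]
  rw [show 2 * (X + c.η / 2) - c.η = 2 * X by ring,
    show X + c.η / 2 - c.η / 2 = X by ring, show -(X + c.η / 2) + c.η / 2 = -X by ring,
    show c.ζ - (X + c.η / 2) + c.η / 2 = c.ζ - X by ring]
  have e1 : ∀ z, sinh z = (exp z - (exp z)⁻¹) / 2 := fun z => by rw [sinh, exp_neg]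
  have e2 : ∀ z, exp (2 * z) = exp z ^ 2 := fun z => by rw [two_mul, exp_add, sq]
  generalize hw : 1 / sinh c.ζ = w
  rw [div_eq_mul_one_div, hw]
  simp only [e1, exp_add, exp_sub, exp_neg, e2]
  have h1 := exp_ne_zero X
  have h2 := exp_ne_zero c.ζ
  have h3 := exp_ne_zero c.τ
  field_simp
  ring

/-- Needed to extend the pseudo-eigenvalue equation to the points where an exchange relation cannot
be divided by its coefficients. -/
theorem continuous_U (c : Chain N) (i j : Fin 2) : Continuous fun x => c.U x i j := by
  suffices h : Continuous c.U from h.matrix_elem i j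
  induction N with
  | zero =>
    have : c.U = fun x => (kMatrix c.η c.ζ c.κ c.τ x).map (algebraMap ℂ (Op 0)) :=
      funext c.U_zero
    rw [this]
    refine continuous_matrix fun i j => ?_
    simp only [Matrix.map_apply, Algebra.algebraMap_eq_smul_one]
    refine Continuous.smul (f := fun x => kMatrix c.η c.ζ c.κ c.τ x i j) ?_ continuous_const
    fin_cases i <;> fin_cases j <;> simp [kMatrix] <;> fun_prop
  | succ N ih =>
    have h₁ : Continuous (lastSite N) :=
      (lastSite N).toLinearMap.continuous_of_finiteDimensional
    have h₂ : Continuous (extendOp N) :=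
      (extendOp N).toLinearMap.continuous_of_finiteDimensional
    have h₃ : Continuous (rBlock c.η) := by
      refine continuous_matrix fun i j => continuous_matrix fun k l => ?_
      simp only [rBlock, Matrix.of_apply, rMatrix_apply, sixVertex]
      split_ifs <;> fun_prop
    have h₄ := ih c.init
    have : c.U = _ := funext c.U_succ
    rw [this]
    have h₅ : Continuous fun x => rBlock c.η (x - c.ξ (Fin.last N) - c.η / 2) :=
      h₃.comp (by fun_prop)
    have h₆ : Continuous fun x => rBlock c.η (x + c.ξ (Fin.last N) - c.η / 2) :=
      h₃.comp (by fun_prop)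
    exact ((h₅.matrix_map h₁).mul (h₄.matrix_map h₂)).mul (h₆.matrix_map h₁)

end Chain

/-! ### Zeros of sinh. -/

theorem sinh_eq_zero_imp {z : ℂ} (h : sinh z = 0) : ∃ k : ℤ, z = k * (Real.pi * I) := by
  have h' : sin (z * I) = 0 := by rw [sin_mul_I, h, zero_mul]
  obtain ⟨k, hk⟩ := sin_eq_zero_iff.1 h'
  refine ⟨-k, ?_⟩
  push_cast
  linear_combination (-I) * hk + z * I_sq

theorem countable_sinh_zero (a : ℂ) : {y : ℂ | sinh (y + a) = 0}.Countable := by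
  refine (Set.countable_range fun k : ℤ => k * (Real.pi * I) - a).mono fun y hy => ?_
  obtain ⟨k, hk⟩ := sinh_eq_zero_imp hy
  exact ⟨k, by simp [← hk]⟩

/-! ### Pseudo-eigenstates generated from the reference state. -/

namespace Chain

/-- The genericity conditions on the inhomogeneities. -/
structure Generic {N : ℕ} (c : Chain N) : Prop where
  sinh_sub : ∀ a b, a ≠ b → sinh (c.ξ a - c.ξ b) ≠ 0
  sinh_sub_add : ∀ a b, a ≠ b → sinh (c.ξ a - c.ξ b + c.η) ≠ 0
  sinh_add : ∀ a b, sinh (c.ξ a + c.ξ b) ≠ 0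
  sinh_add_sub : ∀ a b, sinh (c.η - c.ξ a - c.ξ b) ≠ 0

theorem Generic.init {N : ℕ} {c : Chain (N + 1)} (hc : c.Generic) : c.init.Generic where
  sinh_sub _ _ h := hc.sinh_sub _ _ fun h' => h (Fin.castSucc_injective N h')
  sinh_sub_add _ _ h := hc.sinh_sub_add _ _ fun h' => h (Fin.castSucc_injective N h')
  sinh_add _ _ := hc.sinh_add _ _
  sinh_add_sub _ _ := hc.sinh_add_sub _ _

variable {N : ℕ}

/-- The left reference state in terms of the gauge parameter `T`. -/
def refVec (c : Chain N) (T : ℂ) : (Fin N → Fin 2) → ℂ := fun s =>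
  ∏ n : Fin N, (![-1, T * exp (((N : ℂ) - (n : ℕ)) * c.η - c.ξ n)] : Fin 2 → ℂ) (s n)

/-- The exponent at a site counts the sites from it to the end of the chain, itself included;
removing the last site is therefore absorbed by T → T e^η. -/
theorem refVec_succ (c : Chain (N + 1)) (T : ℂ) :
    c.refVec T = tensorLast (c.init.refVec (T * exp c.η))
      (leftCovector c.η (c.ξ (Fin.last N)) T) := by
  ext s
  rw [refVec, Fin.prod_univ_castSucc, tensorLast, refVec, leftCovector]
  congr 1
  · refine Finset.prod_congr rfl fun n _ => ?_
    have : T * exp (((N + 1 : ℕ) - (n.castSucc : ℕ) : ℂ) * c.η - c.ξ n.castSucc) =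
        T * exp c.η * exp (((N : ℂ) - (n : ℕ)) * c.init.η - c.init.ξ n) := by
      rw [mul_assoc, ← exp_add]
      congr 2
      simp [Chain.init]
      ring
    rw [this]
    rfl
  · have : (((N + 1 : ℕ) : ℂ) - (Fin.last N : ℕ)) * c.η = c.η := by simp
    rw [this]

/-- The indicator configuration of a list of sites. -/
def indicator (l : List (Fin N)) : Fin N → Fin 2 := fun n => if n ∈ l then 1 else 0

/-- The point at which the raising operator of the site `n` is evaluated. -/
def node (c : Chain N) (n : Fin N) : ℂ := c.η / 2 - c.ξ n

/-- The unnormalized states generated by the raising operators of a list of sites. -/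
def listState (c : Chain N) (T : ℂ) (l : List (Fin N)) : (Fin N → Fin 2) → ℂ :=
  l.foldl (fun φ n => Matrix.vecMul φ (c.hatA T (c.node n))) (c.refVec T)

theorem listState_append_singleton (c : Chain N) (T : ℂ) (l : List (Fin N)) (n : Fin N) :
    c.listState T (l ++ [n]) = Matrix.vecMul (c.listState T l) (c.hatA T (c.node n)) := by
  simp [listState]

/-- The pseudo-eigenvalue of `hatB`. -/
def hatEigenvalue (c : Chain N) (h : Fin N → Fin 2) (T x : ℂ) : ℂ :=
  (-1) ^ N * c.boundaryFactor (T * exp (N * c.η)) x * (c.ah h x * c.ah h (-x))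

/-- Peeling off all sites leaves the boundary factor at T e^{Nη}. Each site contributes two sinh
factors, which up to a sign are its factors in a₀(x) and a₀(-x). -/
theorem refVec_vecMul_hatB (c : Chain N) (T x : ℂ) :
    Matrix.vecMul (c.refVec T) (c.hatB T x) =
      c.hatEigenvalue 0 T x • c.refVec (T * exp (-(2 * c.η))) := by
  induction N generalizing T with
  | zero =>
    have h : c.refVec T = c.refVec (T * exp (-(2 * c.η))) := by
      ext s
      simp [refVec]
    rw [hatB_zero, Matrix.vecMul_smul, Matrix.vecMul_one, h]
    simp [hatEigenvalue, ah]
  | succ N ih =>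
    have hc : c.init.η = c.η := rfl
    have h₁ : T * exp c.η * exp (-(2 * c.η)) = T * exp (-(2 * c.η)) * exp c.η := by ring
    have h₂ : c.hatEigenvalue 0 T x = sinh (x - c.ξ (Fin.last N) + c.η / 2) *
        sinh (x + c.ξ (Fin.last N) - c.η / 2) * c.init.hatEigenvalue 0 (T * exp c.η) x := by
      have e₁ : T * exp ((N + 1 : ℕ) * c.η) = T * exp c.η * exp (N * c.init.η) := by
        rw [mul_assoc, ← exp_add, hc]
        push_cast
        ring_nf
      have e₂ : ∀ y, c.ah 0 y = c.init.ah 0 y * sinh (y - c.ξ (Fin.last N) + c.η / 2) := by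
        intro y
        rw [ah, Fin.prod_univ_castSucc, ah]
        congr 1
        simp only [Pi.zero_apply, Fin.val_zero]
        congr 1
        push_cast
        ring
      have e₃ : sinh (-x - c.ξ (Fin.last N) + c.η / 2) =
          - sinh (x + c.ξ (Fin.last N) - c.η / 2) := by
        rw [← sinh_neg]
        ring_nf
      have e₄ : c.boundaryFactor = c.init.boundaryFactor := rfl
      rw [hatEigenvalue, hatEigenvalue, e₁, e₂, e₂, e₃, e₄]
      ring
    rw [refVec_succ, tensorLast_vecMul_hatB, ih, refVec_succ, hc, h₁, h₂]
    ext s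
    simp only [tensorLast, Pi.smul_apply, smul_eq_mul]
    ring

theorem ah_indicator_node (c : Chain N) {l : List (Fin N)} {n : Fin N} (hn : n ∉ l) :
    c.ah (indicator l) (-c.node n) = 0 := by
  refine Finset.prod_eq_zero (Finset.mem_univ n) ?_
  simp only [indicator, hn, if_false, node, Fin.val_zero]
  rw [← sinh_zero]
  congr 1
  push_cast
  ring

/-- Occupying n changes a single factor of the product; cross-multiplying avoids dividing by it. -/
theorem ah_indicator_append (c : Chain N) {l : List (Fin N)} {n : Fin N} (hn : n ∉ l) (x : ℂ) :
    sinh (x - c.ξ n + c.η / 2) * c.ah (indicator (l ++ [n])) x =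
      sinh (x - c.ξ n - c.η / 2) * c.ah (indicator l) x := by
  rw [ah, ah, ← Finset.mul_prod_erase _ _ (Finset.mem_univ n),
    ← Finset.mul_prod_erase Finset.univ (fun m => sinh (x - c.ξ m -
      (((indicator l m : ℕ) : ℂ) - 1 / 2) * c.η)) (Finset.mem_univ n)]
  have h : ∀ m ∈ Finset.univ.erase n, indicator (l ++ [n]) m = indicator l m := by
    intro m hm
    simp [indicator, Finset.ne_of_mem_erase hm]
  rw [Finset.prod_congr rfl fun m hm => by rw [h m hm]]
  simp only [indicator, hn, if_false, Fin.val_zero, List.mem_append, List.mem_singleton, or_true,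
    if_true, Fin.val_one, Nat.cast_one, Nat.cast_zero]
  ring_nf

theorem continuous_ah (c : Chain N) (h : Fin N → Fin 2) : Continuous (c.ah h) := by
  unfold ah
  fun_prop

theorem continuous_hatB (c : Chain N) (T : ℂ) : Continuous (c.hatB T) := by
  have := c.continuous_U
  unfold hatB
  fun_prop

theorem continuous_hatEigenvalue (c : Chain N) (h : Fin N → Fin 2) (T : ℂ) :
    Continuous (c.hatEigenvalue h T) := by
  have := c.continuous_ah h
  unfold hatEigenvalue boundaryFactor
  fun_prop

/-- Each new raising operator is commuted past `hatB` by the exchange relation, whose coefficients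
supply exactly the change of the factors of site n in a_h(x) a_h(-x). -/
theorem listState_vecMul_hatB (c : Chain N) (T x : ℂ) {l : List (Fin N)} (hl : l.Nodup) :
    Matrix.vecMul (c.listState T l) (c.hatB T x) =
      c.hatEigenvalue (indicator l) T x • c.listState (T * exp (-(2 * c.η))) l := by
  induction l using List.reverseRecOn generalizing x with
  | nil =>
    have : indicator ([] : List (Fin N)) = 0 := by
      ext n
      simp [indicator]
    rw [this]
    exact c.refVec_vecMul_hatB T x
  | append_singleton l n ih =>
    obtain ⟨hl, -, hn⟩ := List.nodup_append.1 hl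
    replace hn : n ∉ l := fun h => hn n h n (by simp) rfl
    have h₀ : Matrix.vecMul (c.listState T l) (c.hatB T (c.node n)) = 0 := by
      rw [ih _ hl, hatEigenvalue, ah_indicator_node c hn]
      simp
    -- The three sets are the zeros of the factors to be cancelled. Their union is countable, so its
    -- complement is dense and continuity gives the remaining points.
    have hs : ({y : ℂ | sinh (y + -(c.node n + c.η)) = 0} ∪ {y : ℂ | sinh (y + c.node n) = 0} ∪
        {y : ℂ | sinh (y + -c.node n) = 0}).Countable :=
      ((countable_sinh_zero _).union (countable_sinh_zero _)).union (countable_sinh_zero _)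
    refine congrFun (Continuous.ext_on (hs.dense_compl ℂ)
      (f := fun x => Matrix.vecMul (c.listState T (l ++ [n])) (c.hatB T x))
      (g := fun x => c.hatEigenvalue (indicator (l ++ [n])) T x •
        c.listState (T * exp (-(2 * c.η))) (l ++ [n])) ?_ ?_ ?_) x
    · exact continuous_const.matrix_vecMul (c.continuous_hatB T)
    · exact (c.continuous_hatEigenvalue _ T).smul continuous_const
    · intro y hy
      simp only [Set.mem_compl_iff, Set.mem_union, Set.mem_ofPred_eq, not_or] at hy
      obtain ⟨⟨hy₁, hy₂⟩, hy₃⟩ := hy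
      have h₁ : sinh (c.node n - y + c.η) ≠ 0 := fun h => hy₁ (by
        rw [← neg_eq_zero, ← sinh_neg, ← h]
        ring_nf)
      have key := c.vecMul_hatA_hatB (y := y) h₀ h₁
      rw [ih _ hl, Matrix.smul_vecMul, ← listState_append_singleton,
        ← listState_append_singleton, smul_smul] at key
      have h₂ : sinh (c.node n + y) * sinh (y - c.node n) ≠ 0 := by
        rw [add_comm, sub_eq_add_neg]
        exact mul_ne_zero hy₂ hy₃
      refine smul_right_injective _ h₂ ?_
      simp only
      rw [key, smul_smul]
      congr 1
      have a₁ := c.ah_indicator_append hn y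
      have a₂ := c.ah_indicator_append hn (-y)
      rw [show y - c.ξ n + c.η / 2 = c.node n + y by rw [node]; ring,
        show y - c.ξ n - c.η / 2 = c.node n + y - c.η by rw [node]; ring] at a₁
      rw [show -y - c.ξ n + c.η / 2 = -(y - c.node n) by rw [node]; ring,
        show -y - c.ξ n - c.η / 2 = -(y - c.node n + c.η) by rw [node]; ring, sinh_neg,
        sinh_neg] at a₂
      rw [hatEigenvalue, hatEigenvalue]
      linear_combination (-1) ^ N * c.boundaryFactor (T * exp (N * c.η)) y *
        (-(sinh (y - c.node n) * c.ah (indicator (l ++ [n])) (-y)) * a₁ +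
        sinh (c.node n + y - c.η) * c.ah (indicator l) y * a₂)

theorem listState_vecMul_hatB_node (c : Chain N) (T : ℂ) {l : List (Fin N)} (hl : l.Nodup)
    {n : Fin N} (hn : n ∉ l) : Matrix.vecMul (c.listState T l) (c.hatB T (c.node n)) = 0 := by
  rw [c.listState_vecMul_hatB T _ hl, hatEigenvalue, ah_indicator_node c hn]
  simp

theorem Generic.listState_perm {c : Chain N} (hc : c.Generic) (T : ℂ) {l l' : List (Fin N)}
    (h : l.Perm l') (hl : l.Nodup) : c.listState T l = c.listState T l' := by
  -- The head of the list acts first, so a transposition has to be allowed after an arbitrary prefix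
  -- p; the operators that follow act on equal covectors.
  suffices H : ∀ p : List (Fin N), (p ++ l).Nodup →
      c.listState T (p ++ l) = c.listState T (p ++ l') from H [] hl
  clear hl
  induction h with
  | nil => intro p _; rfl
  | cons n _ ih =>
    intro p hp
    simpa using ih (p ++ [n]) (by simpa using hp)
  | swap n m l =>
    intro p hp
    have hp' : (p ++ [m, n]).Nodup := by
      refine hp.sublist ?_
      simp
    have hpl : p.Nodup := (List.nodup_append.1 hp').1
    have hm : m ∉ p := fun h => (List.nodup_append.1 hp').2.2 m h m (by simp) rfl
    have hn : n ∉ p := fun h => (List.nodup_append.1 hp').2.2 n h n (by simp) rfl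
    have hmn : n ≠ m := by
      have := (List.nodup_append.1 hp').2.1
      simp at this
      exact fun h => this h.symm
    have key := c.vecMul_hatA_hatA (c.listState_vecMul_hatB_node T hpl hm)
      (c.listState_vecMul_hatB_node T hpl hn)
      (by
        have := hc.sinh_sub_add n m hmn
        rwa [node, node, show c.η / 2 - c.ξ m - (c.η / 2 - c.ξ n) = c.ξ n - c.ξ m by ring])
      (by
        have := hc.sinh_add_sub n m
        rwa [node, node, show c.η / 2 - c.ξ m + (c.η / 2 - c.ξ n) = c.η - c.ξ n - c.ξ m by ring])
    simp only [listState, List.foldl_append, List.foldl_cons] at key ⊢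
    rw [key]
  | trans h₁ _ ih₁ ih₂ =>
    intro p hp
    exact (ih₁ p hp).trans (ih₂ p ((h₁.append_left p).nodup_iff.1 hp))

end Chain

/-! ### From the gauge-transformed operators to `hatA` and `hatB`. -/

namespace Chain

variable {N : ℕ}

theorem Gtilde_eq (c : Chain N) (x β : ℂ) : c.Gtilde x β =
    !![exp (-(x + (c.α + β + 1) * c.η)), exp (-(x + (c.α - β + 1) * c.η)); 1, 1] := by
  ext i j
  fin_cases i <;> fin_cases j <;> simp [Gtilde, X, Y] <;> ring_nf

/-- Only the first row enters 𝒜₋ and ℬ₋. When sinh(βη) = 0 both sides are 0 by the conventions for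
inverses and division. -/
theorem Gtilde_inv (c : Chain N) (x β : ℂ) :
    (c.Gtilde x β)⁻¹ 0 0 = -exp (x + (c.α + 1) * c.η) / (2 * sinh (β * c.η)) ∧
      (c.Gtilde x β)⁻¹ 0 1 = exp (x + (c.α + 1) * c.η) / (2 * sinh (β * c.η)) *
        exp (-(x + (c.α - β + 1) * c.η)) := by
  have hdet : (c.Gtilde x β).det =
      -(2 * sinh (β * c.η)) * (exp (x + (c.α + 1) * c.η))⁻¹ := by
    rw [Gtilde_eq, Matrix.det_fin_two_of, ← exp_neg, sinh,
      show -(x + (c.α + β + 1) * c.η) = -(x + (c.α + 1) * c.η) + -(β * c.η) by ring,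
      show -(x + (c.α - β + 1) * c.η) = -(x + (c.α + 1) * c.η) + β * c.η by ring, exp_add,
      exp_add]
    ring
  have he := exp_ne_zero (x + (c.α + 1) * c.η)
  rw [Matrix.inv_def, hdet, Ring.inverse_eq_inv', Gtilde_eq, Matrix.adjugate_fin_two_of]
  constructor <;> simp <;> field_simp

/-- The first row of G̃⁻¹ annihilates the column Y, and the second column of G̃ is Y itself, so up
to scalars only T survives; the prefactor e^{-x+η/2} cancels the x-dependence of the determinant. -/
theorem opB_eq (c : Chain N) {β : ℂ} (hβ : sinh (β * c.η) ≠ 0) (x : ℂ) :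
    c.opB x β = (-exp ((c.α + 1) * c.η) / (2 * sinh (β * c.η))) •
      c.hatB (exp (-(c.α - β + 1) * c.η)) x := by
  obtain ⟨h₁, h₂⟩ := c.Gtilde_inv (x - c.η / 2) β
  obtain ⟨X, rfl⟩ : ∃ X, x = X + c.η / 2 := ⟨x - c.η / 2, by ring⟩
  rw [add_sub_cancel_right] at h₁ h₂
  simp only [opB, gaugedU, Matrix.smul_apply, Matrix.mul_apply, Fin.sum_univ_two, aux,
    add_sub_cancel_right, h₁, h₂, Gtilde_eq c (c.η / 2 - (X + c.η / 2)), hatB, Matrix.of_apply,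
    Matrix.cons_val', Matrix.cons_val_zero, Matrix.cons_val_one, Matrix.cons_val_fin_one,
    smul_mul_assoc, mul_smul_comm, one_mul, mul_one]
  rw [show c.η / 2 - (X + c.η / 2) = -X by ring, show -(X + c.η / 2) + c.η / 2 = -X by ring,
    show -(-X + (c.α - β + 1) * c.η) = X + -(c.α - β + 1) * c.η by ring,
    show -(X + (c.α - β + 1) * c.η) = -X + -(c.α - β + 1) * c.η by ring]
  simp only [exp_add, exp_neg X]
  have hX := exp_ne_zero X
  generalize exp X = p at *
  generalize exp (-(c.α - β + 1) * c.η) = T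
  generalize exp ((c.α + 1) * c.η) = r
  match_scalars <;> field_simp

/-- The column X differs from Y by a multiple of (1, 0): the Y part gives `hatB`, the rest gives
`hatA`. -/
theorem opA_eq (c : Chain N) {β : ℂ} (hβ : sinh (β * c.η) ≠ 0) (x : ℂ) :
    c.opA x (β + 2) = exp (x - c.η / 2) • c.hatA (exp (-(c.α - β + 1) * c.η)) x +
      (-exp ((c.α + 1) * c.η) / (2 * sinh (β * c.η))) •
        c.hatB (exp (-(c.α - β + 1) * c.η)) x := by
  obtain ⟨h₁, h₂⟩ := c.Gtilde_inv (x - c.η / 2) β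
  obtain ⟨X, rfl⟩ : ∃ X, x = X + c.η / 2 := ⟨x - c.η / 2, by ring⟩
  rw [add_sub_cancel_right] at h₁ h₂
  simp only [opA, gaugedU, Matrix.smul_apply, Matrix.mul_apply, Fin.sum_univ_two, aux,
    add_sub_cancel_right, h₁, h₂, Gtilde_eq c (c.η / 2 - (X + c.η / 2)), hatA, hatB,
    Matrix.of_apply, Matrix.cons_val', Matrix.cons_val_zero, Matrix.cons_val_one,
    Matrix.cons_val_fin_one, smul_mul_assoc, mul_smul_comm, one_mul, mul_one]
  have hT : exp (X + -(c.α + β + 1) * c.η) = exp X * (exp (-(c.α - β + 1) * c.η) -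
      2 * sinh (β * c.η) * (exp ((c.α + 1) * c.η))⁻¹) := by
    rw [← exp_neg, sinh, exp_add,
      show -(c.α + β + 1) * c.η = -((c.α + 1) * c.η) + -(β * c.η) by ring,
      show -(c.α - β + 1) * c.η = -((c.α + 1) * c.η) + β * c.η by ring, exp_add, exp_add]
    ring
  rw [show c.η / 2 - (X + c.η / 2) = -X by ring, show -(X + c.η / 2) + c.η / 2 = -X by ring,
    show -(-X + (c.α + β + 1) * c.η) = X + -(c.α + β + 1) * c.η by ring,
    show -(X + (c.α - β + 1) * c.η) = -X + -(c.α - β + 1) * c.η by ring, hT]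
  simp only [exp_add, exp_neg X]
  have hX := exp_ne_zero X
  have hr := exp_ne_zero ((c.α + 1) * c.η)
  generalize exp X = p at *
  generalize exp (-(c.α - β + 1) * c.η) = T
  generalize exp ((c.α + 1) * c.η) = r at *
  generalize sinh (β * c.η) = s at *
  match_scalars <;> field_simp <;> ring

theorem refState_eq (c : Chain N) (β : ℂ) :
    c.refState β = c.refVec (exp (-(c.α - β + 1) * c.η)) := by
  ext s
  refine Finset.prod_congr rfl fun n _ => ?_
  rw [← exp_add]
  congr 5
  ring

/-- The sites occupied by a configuration. -/
def occupied (h : Fin N → Fin 2) (l : List (Fin N)) : List (Fin N) := l.filter fun n => h n = 1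

theorem indicator_occupied_finRange (h : Fin N → Fin 2) :
    indicator (occupied h (List.finRange N)) = h := by
  ext n
  simp only [indicator, occupied, List.mem_filter, List.mem_finRange, true_and, decide_eq_true_eq]
  have : h n = 0 ∨ h n = 1 := by
    generalize h n = b
    fin_cases b <;> simp
  rcases this with h' | h' <;> simp [h']

/-- At the node of a site not yet raised the `hatB` part of `opA` kills the state, so `opA` acts as
a multiple of `hatA`. -/
theorem vecMul_refState_prod (c : Chain N) {β : ℂ} (hβ : sinh (β * c.η) ≠ 0) (w : Fin N → ℂ)
    (h : Fin N → Fin 2) {l : List (Fin N)} (hl : l.Nodup) :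
    Matrix.vecMul (c.refState β)
        (l.map fun n => (w n • c.opA (c.node n) (β + 2)) ^ (h n : ℕ)).prod =
      (l.map fun n => (w n * exp (c.node n - c.η / 2)) ^ (h n : ℕ)).prod •
        c.listState (exp (-(c.α - β + 1) * c.η)) (occupied h l) := by
  induction l using List.reverseRecOn with
  | nil => simp [occupied, listState, refState_eq]
  | append_singleton l n ih =>
    obtain ⟨hl, -, hn⟩ := List.nodup_append.1 hl
    replace hn : n ∉ l := fun h => hn n h n (by simp) rfl
    have hn' : n ∉ occupied h l := fun h' => hn (List.mem_filter.1 h').1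
    have hb : h n = 0 ∨ h n = 1 := by
      generalize h n = b
      fin_cases b <;> simp
    rw [List.map_append, List.prod_append, ← Matrix.vecMul_vecMul, ih hl]
    rcases hb with hb | hb
    · simp [hb, occupied]
    · have : occupied h (l ++ [n]) = occupied h l ++ [n] := by simp [occupied, hb]
      rw [this, listState_append_singleton]
      simp only [List.map_cons, List.map_nil, List.prod_cons, List.prod_nil, mul_one, hb,
        Fin.val_one, pow_one, List.map_append, List.prod_append]
      rw [opA_eq c hβ, Matrix.smul_vecMul, Matrix.vecMul_smul, Matrix.vecMul_add,
        Matrix.vecMul_smul, Matrix.vecMul_smul,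
        listState_vecMul_hatB_node c _ (l := occupied h l) (hl.filter _) hn', smul_zero, add_zero, smul_smul,
        smul_smul, mul_assoc]

/-! ### Linear independence by induction on the number of sites. -/

theorem Generic.listState_map_castSucc {c : Chain (N + 1)} (hc : c.Generic) (T : ℂ)
    {l : List (Fin N)} (hl : l.Nodup) :
    ∃ r : ℂ, r ≠ 0 ∧ c.listState T (l.map Fin.castSucc) =
      r • tensorLast (c.init.listState (T * exp c.η) l)
        (leftCovector c.η (c.ξ (Fin.last N)) T) := by
  induction l using List.reverseRecOn with
  | nil => exact ⟨1, one_ne_zero, by simp [listState, refVec_succ]⟩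
  | append_singleton l n ih =>
    obtain ⟨hl, -, hn⟩ := List.nodup_append.1 hl
    replace hn : n ∉ l := fun h => hn n h n (by simp) rfl
    obtain ⟨r, hr, h⟩ := ih hl
    have h₀ := c.init.listState_vecMul_hatB_node (T * exp c.η) hl hn
    have hn : c.node n.castSucc = c.init.node n := rfl
    refine ⟨r * (sinh (c.init.node n - c.ξ (Fin.last N) + c.η / 2) *
      sinh (c.init.node n + c.ξ (Fin.last N) + c.η / 2)), ?_, ?_⟩
    · refine mul_ne_zero hr (mul_ne_zero ?_ ?_)
      · have := hc.sinh_add_sub n.castSucc (Fin.last N)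
        rwa [← hn, node, show c.η / 2 - c.ξ n.castSucc - c.ξ (Fin.last N) + c.η / 2 =
          c.η - c.ξ n.castSucc - c.ξ (Fin.last N) by ring]
      · have := hc.sinh_sub_add (Fin.last N) n.castSucc (Fin.castSucc_ne_last n).symm
        rwa [← hn, node, show c.η / 2 - c.ξ n.castSucc + c.ξ (Fin.last N) + c.η / 2 =
          c.ξ (Fin.last N) - c.ξ n.castSucc + c.η by ring]
    · rw [List.map_append, List.map_singleton, listState_append_singleton, h, hn,
        Matrix.smul_vecMul, tensorLast_vecMul_hatA, h₀, listState_append_singleton]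
      ext s
      simp only [tensorLast, Pi.smul_apply, Pi.add_apply, Pi.zero_apply, smul_eq_mul]
      ring

/-- The factor of the pseudo-eigenvalues which depends on the gauge parameter. -/
def gaugeFactor (c : Chain N) (T : ℂ) : ℂ :=
  c.κ * (exp c.τ - T ^ 2 * exp (-c.τ)) + T * exp c.ζ

theorem occupied_finRange_succ (h : Fin (N + 1) → Fin 2) :
    occupied h (List.finRange (N + 1)) =
      (occupied (Fin.init h) (List.finRange N)).map Fin.castSucc ++
        occupied h [Fin.last N] := by
  rw [occupied, List.finRange_succ_last, List.filter_append, List.filter_map]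
  rfl

theorem Generic.init_ah_node_ne_zero {c : Chain (N + 1)} (hc : c.Generic) (h : Fin N → Fin 2) :
    c.init.ah h (c.node (Fin.last N)) * c.init.ah h (-c.node (Fin.last N)) ≠ 0 := by
  rw [ah, ah, ← Finset.prod_mul_distrib]
  refine Finset.prod_ne_zero_iff.2 fun m _ => ?_
  have hm := Fin.castSucc_ne_last m
  have hb : h m = 0 ∨ h m = 1 := by
    generalize h m = b
    fin_cases b <;> simp
  have e₁ : c.init.ξ m = c.ξ m.castSucc := rfl
  have e₂ : c.init.η = c.η := rfl
  rw [e₁, e₂, node]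
  rcases hb with hb | hb
  · simp only [hb, Fin.val_zero, Nat.cast_zero]
    refine mul_ne_zero ?_ ?_
    · convert hc.sinh_add_sub (Fin.last N) m.castSucc using 2
      ring
    · convert hc.sinh_sub (Fin.last N) m.castSucc hm.symm using 2
      ring
  · simp only [hb, Fin.val_one, Nat.cast_one]
    refine mul_ne_zero ?_ ?_
    · rw [← neg_ne_zero, ← sinh_neg]
      convert hc.sinh_add (Fin.last N) m.castSucc using 2
      ring
    · rw [← neg_ne_zero, ← sinh_neg]
      convert hc.sinh_sub_add m.castSucc (Fin.last N) hm using 2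
      ring

theorem Generic.listState_linearIndependent {c : Chain N} (hc : c.Generic)
    (hζ : sinh c.ζ ≠ 0) (hη : 0 < N → sinh c.η ≠ 0) (T : ℂ)
    (hT : ∀ j < N, c.gaugeFactor (T * exp (((N : ℂ) - 2 * (j : ℕ)) * c.η)) ≠ 0) :
    LinearIndependent ℂ fun h => c.listState T (occupied h (List.finRange N)) := by
  induction N generalizing T with
  | zero =>
    refine Fintype.linearIndependent_iff.2 fun g hg i => ?_
    have := congrFun hg default
    rw [Finset.sum_apply, Fintype.sum_eq_single i fun j hj => absurd (Subsingleton.elim j i) hj]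
      at this
    simpa [occupied, listState, refVec] using this
  | succ N ih =>
    have hη := hη N.succ_pos
    -- The shorter chain is needed at T e^η, for the states themselves, and at T e^{-η}, for their
    -- images under `hatB`. Its gauge conditions are the given ones at j and at j + 1.
    have ih₁ := ih hc.init hζ (fun _ => hη) (T * exp c.η) (by
      intro j hj
      have := hT j (by omega)
      convert this using 1
      change c.gaugeFactor _ = _
      rw [mul_assoc, ← exp_add]
      congr 3
      push_cast
      change c.η + (N - 2 * j) * c.η = _
      ring)
    have ih₂ := ih hc.init hζ (fun _ => hη) (T * exp c.η * exp (-(2 * c.η))) (by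
      intro j hj
      have := hT (j + 1) (by omega)
      convert this using 1
      change c.gaugeFactor _ = _
      rw [mul_assoc, mul_assoc, ← exp_add, ← exp_add]
      congr 3
      push_cast
      change c.η + (-(2 * c.η) + (N - 2 * j) * c.η) = _
      ring)
    set ξ := c.ξ (Fin.last N)
    set T' := T * exp c.η
    choose r hr hst using fun h : Fin N → Fin 2 =>
      hc.listState_map_castSucc T ((List.nodup_finRange N).filter fun n => h n = 1)
    -- the states with last occupation number `0` or `1`
    have hS₀ : ∀ h : Fin N → Fin 2, c.listState T
        (occupied (Fin.snoc h 0 : Fin (N + 1) → Fin 2) (List.finRange (N + 1))) =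
        r h • tensorLast (c.init.listState T' (occupied h (List.finRange N)))
          (leftCovector c.η ξ T) := by
      intro h
      rw [occupied_finRange_succ, Fin.init_snoc]
      simpa [occupied] using hst h
    have hS₁ : ∀ h : Fin N → Fin 2, c.listState T
        (occupied (Fin.snoc h 1 : Fin (N + 1) → Fin 2) (List.finRange (N + 1))) =
        Matrix.vecMul (r h • tensorLast (c.init.listState T' (occupied h (List.finRange N)))
          (leftCovector c.η ξ T)) (c.hatA T (c.node (Fin.last N))) := by
      intro h
      rw [occupied_finRange_succ, Fin.init_snoc]
      have : occupied (Fin.snoc h 1 : Fin (N + 1) → Fin 2) [Fin.last N] = [Fin.last N] := by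
        simp [occupied]
      rw [this, listState_append_singleton]
      congr 1
      exact hst h
    -- contraction of the last site with a vector annihilated by the reference covector
    have hc₀ : ∀ (h : Fin N → Fin 2) s, c.listState T
        (occupied (Fin.snoc h 0 : Fin (N + 1) → Fin 2) (List.finRange (N + 1))) (Fin.snoc s 0) *
          (T * exp (c.η - ξ)) + c.listState T
        (occupied (Fin.snoc h 0 : Fin (N + 1) → Fin 2) (List.finRange (N + 1))) (Fin.snoc s 1) =
        0 := by
      intro h s
      rw [hS₀]
      simp [tensorLast, leftCovector]
      ring
    -- q is the coefficient left by the contraction: -sinh η from the remainder in the action of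
    -- `hatA`, times the pseudo-eigenvalue of the shorter chain at the node of the last site.
    obtain ⟨q, hq⟩ : ∃ q : (Fin N → Fin 2) → ℂ, ∀ h, q h = - r h * sinh c.η *
        sinh (c.node (Fin.last N) - ξ + c.η / 2) *
        c.init.hatEigenvalue h T' (c.node (Fin.last N)) := ⟨_, fun _ => rfl⟩
    have hq₀ : ∀ h, q h ≠ 0 := by
      intro h
      rw [hq]
      refine mul_ne_zero (mul_ne_zero (mul_ne_zero (neg_ne_zero.2 (hr h)) hη) ?_) ?_
      · have := hc.sinh_add_sub (Fin.last N) (Fin.last N)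
        rwa [node, show c.η / 2 - c.ξ (Fin.last N) - ξ + c.η / 2 =
          c.η - c.ξ (Fin.last N) - c.ξ (Fin.last N) by ring]
      · rw [hatEigenvalue]
        refine mul_ne_zero (mul_ne_zero (pow_ne_zero _ (by norm_num)) ?_)
          (hc.init_ah_node_ne_zero h)
        refine mul_ne_zero (div_ne_zero ?_ hζ) ?_
        · rw [← neg_ne_zero, ← sinh_neg]
          convert hc.sinh_add (Fin.last N) (Fin.last N) using 2
          change -(2 * (c.η / 2 - c.ξ (Fin.last N)) - c.η) = _
          ring
        -- The boundary factor of the shorter chain sits at T' e^{Nη} = T e^{(N+1)η}, which is the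
        -- condition for j = 0.
        · have := hT 0 N.succ_pos
          convert this using 1
          change c.gaugeFactor _ = _
          simp only [T']
          rw [mul_assoc, ← exp_add]
          congr 3
          push_cast
          change c.η + N * c.η = _
          ring
    have hc₁ : ∀ (h : Fin N → Fin 2) s, c.listState T
        (occupied (Fin.snoc h 1 : Fin (N + 1) → Fin 2) (List.finRange (N + 1))) (Fin.snoc s 0) *
          (T * exp (c.η - ξ)) + c.listState T
        (occupied (Fin.snoc h 1 : Fin (N + 1) → Fin 2) (List.finRange (N + 1))) (Fin.snoc s 1) =
        q h * c.init.listState (T' * exp (-(2 * c.η))) (occupied h (List.finRange N)) s := by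
      intro h s
      have hB := c.init.listState_vecMul_hatB T' (c.node (Fin.last N))
        ((List.nodup_finRange N).filter fun n => h n = 1)
      change Matrix.vecMul (c.init.listState T' (occupied h (List.finRange N))) _ =
        c.init.hatEigenvalue (indicator (occupied h (List.finRange N))) _ _ •
        c.init.listState (T' * exp (-(2 * c.η))) (occupied h (List.finRange N)) at hB
      rw [indicator_occupied_finRange] at hB
      rw [hS₁, Matrix.smul_vecMul, tensorLast_vecMul_hatA, hB, hq]
      simp [tensorLast, leftCovector]
      ring
    refine Fintype.linearIndependent_iff.2 fun g hg => ?_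
    rw [sum_config_succ, Fin.sum_univ_two] at hg
    have hg' : ∀ s, (∑ h : Fin N → Fin 2, g (Fin.snoc h 0) * c.listState T
        (occupied (Fin.snoc h 0 : Fin (N + 1) → Fin 2) (List.finRange (N + 1))) s) +
        ∑ h : Fin N → Fin 2, g (Fin.snoc h 1) * c.listState T
        (occupied (Fin.snoc h 1 : Fin (N + 1) → Fin 2) (List.finRange (N + 1))) s = 0 := by
      intro s
      simpa [Finset.sum_apply] using congrFun hg s
    have g₁ : ∀ h : Fin N → Fin 2, g (Fin.snoc h 1) = 0 := by
      -- The combination of the components s0 and s1 with weights T e^{η-ξ} and 1 removes every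
      -- state with last label 0.
      have := Fintype.linearIndependent_iff.1 ih₂ (fun h => g (Fin.snoc h 1) * q h) (by
        ext s
        simp only [Finset.sum_apply, Pi.smul_apply, smul_eq_mul, Pi.zero_apply, mul_assoc,
          ← hc₁]
        have a₀ := hg' (Fin.snoc s 0)
        have a₁ := hg' (Fin.snoc s 1)
        have a₂ : ∑ h : Fin N → Fin 2, g (Fin.snoc h 0) * (c.listState T
          (occupied (Fin.snoc h 0 : Fin (N + 1) → Fin 2) (List.finRange (N + 1))) (Fin.snoc s 0) *
          (T * exp (c.η - ξ)) + c.listState T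
          (occupied (Fin.snoc h 0 : Fin (N + 1) → Fin 2) (List.finRange (N + 1)))
            (Fin.snoc s 1)) = 0 :=
          Finset.sum_eq_zero fun h _ => by rw [hc₀, mul_zero]
        simp only [mul_add, Finset.sum_add_distrib, ← mul_assoc, ← Finset.sum_mul] at a₂ ⊢
        linear_combination T * exp (c.η - ξ) * a₀ + a₁ - a₂)
      exact fun h => (mul_eq_zero.1 (this h)).resolve_right (hq₀ h)
    have g₀ : ∀ h : Fin N → Fin 2, g (Fin.snoc h 0) = 0 := by
      have := Fintype.linearIndependent_iff.1 ih₁ (fun h => g (Fin.snoc h 0) * r h) (by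
        ext s
        have a₀ := hg' (Fin.snoc s 0)
        simp only [g₁, zero_mul, Finset.sum_const_zero, add_zero, hS₀] at a₀
        simp only [Finset.sum_apply, Pi.smul_apply, smul_eq_mul, Pi.zero_apply]
        rw [← neg_eq_zero, ← a₀, ← Finset.sum_neg_distrib]
        refine Finset.sum_congr rfl fun h _ => ?_
        simp [tensorLast, leftCovector]
        ring)
      exact fun h => (mul_eq_zero.1 (this h)).resolve_right (hr h)
    intro h
    rw [← Fin.snoc_init_self h]
    generalize h (Fin.last N) = b
    fin_cases b
    · exact g₀ _
    · exact g₁ _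

end Chain

/-! ### Translation of the assumptions, and conclusion. -/

theorem sinh_eq_sinh_imp {a b : ℂ} (h : sinh a = sinh b) :
    ∃ k : ℤ, a = (-1 : ℂ) ^ k * b - k * (Real.pi * I) := by
  -- The two factors give the even and the odd values of k.
  have h' : (exp a - exp b) * (1 + exp (-a - b)) = 0 := by
    rw [sinh, sinh] at h
    rw [exp_sub, mul_add, exp_neg] at *
    have ha := exp_ne_zero a
    have hb := exp_ne_zero b
    rw [exp_neg] at h
    field_simp at h ⊢
    linear_combination h
  rcases mul_eq_zero.1 h' with h' | h'
  · obtain ⟨n, hn⟩ := exp_eq_exp_iff_exists_int.1 (sub_eq_zero.1 h')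
    refine ⟨-(2 * n), ?_⟩
    rw [Even.neg_one_zpow (by simp), hn]
    push_cast
    ring
  · have : exp (-a - b) = exp (Real.pi * I) := by
      rw [exp_pi_mul_I]
      linear_combination h'
    obtain ⟨n, hn⟩ := exp_eq_exp_iff_exists_int.1 this
    refine ⟨2 * n + 1, ?_⟩
    rw [Odd.neg_one_zpow (by simp)]
    push_cast
    linear_combination -hn

namespace Chain

variable {N : ℕ}

/-- The ratio between the states `⟨β,h|` and the unnormalized ones. -/
def stateScale (c : Chain N) (αm βm : ℂ) (h : Fin N → Fin 2) : ℂ :=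
  ∏ n, ((c.scalarA αm βm (c.node n))⁻¹ * exp (c.node n - c.η / 2)) ^ (h n : ℕ)

theorem Generic.sovStateOrdered_eq {c : Chain N} (hc : c.Generic) (αm βm : ℂ) {β : ℂ}
    (hβ : sinh (β * c.η) ≠ 0) (σ : Equiv.Perm (Fin N)) (h : Fin N → Fin 2) :
    c.sovStateOrdered αm βm σ β h = c.stateScale αm βm h •
      c.listState (exp (-(c.α - β + 1) * c.η)) (occupied h (List.finRange N)) := by
  have hnd : ((List.finRange N).map σ).Nodup := (List.nodup_finRange N).map σ.injective
  have hperm : ((List.finRange N).map σ).Perm (List.finRange N) :=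
    (List.perm_ext_iff_of_nodup hnd (List.nodup_finRange N)).2 fun n => by
      simp only [List.mem_map, List.mem_finRange, true_and, iff_true]
      exact σ.surjective n
  have key := c.vecMul_refState_prod hβ (fun n => (c.scalarA αm βm (c.node n))⁻¹) h hnd
  rw [(hperm.map _).prod_eq, List.map_map] at key
  rw [stateScale, Fin.prod_univ_def]
  refine key.trans ?_
  congr 1
  exact hc.listState_perm _ (hperm.filter _) (hnd.filter _)

theorem hatEigenvalue_eq (c : Chain N) (β : ℂ) (hζ : sinh c.ζ ≠ 0) (h : Fin N → Fin 2)
    (x : ℂ) : -exp ((c.α + 1) * c.η) / (2 * sinh (β * c.η)) *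
      c.hatEigenvalue h (exp (-(c.α - β + 1) * c.η)) x = c.pseudoEigenvalue h x β := by
  obtain ⟨Z, hZ⟩ : ∃ Z, Z = exp (((N : ℂ) + β - c.α - 1) * c.η) := ⟨_, rfl⟩
  have hZ₀ : Z ≠ 0 := hZ ▸ exp_ne_zero _
  have e₁ : exp (-(c.α - β + 1) * c.η) * exp (N * c.η) = Z := by
    rw [hZ, ← exp_add]
    ring_nf
  have e₂ : exp ((β + N) * c.η) = exp ((c.α + 1) * c.η) * Z := by
    rw [hZ, ← exp_add]
    ring_nf
  rw [hatEigenvalue, pseudoEigenvalue, boundaryFactor, e₁, e₂,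
    show sinh (((N : ℂ) + β - c.α - 1) * c.η - c.τ) = (Z / exp c.τ - exp c.τ / Z) / 2 by
      rw [sinh, neg_sub, exp_sub, exp_sub, hZ], exp_neg]
  have hτ := exp_ne_zero c.τ
  field_simp
  ring

/-- At T = e^{w+τ} the factor is e^{w+τ}(e^ζ - 2κ sinh w), and e^ζ = 2κ sinh(α₋+β₋) by adding the
two defining relations. It thus vanishes only if sinh w = sinh(α₋+β₋). -/
theorem gaugeFactor_ne_zero (c : Chain N) {αm βm β : ℂ} (hκ : c.κ ≠ 0)
    (h₁ : sinh αm * cosh βm = sinh c.ζ / (2 * c.κ))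
    (h₂ : cosh αm * sinh βm = cosh c.ζ / (2 * c.κ)) (j : ℕ)
    (h : ∀ k : ℤ, (c.α - (β - 2 * j)) * c.η ≠
      ((N : ℂ) - 1) * c.η - c.τ - (-1 : ℂ) ^ k * (αm + βm) + k * (Real.pi * I)) :
    c.gaugeFactor (exp (-(c.α - β + 1) * c.η) * exp (((N : ℂ) - 2 * j) * c.η)) ≠ 0 := by
  intro h0
  have hs : sinh (αm + βm) = exp c.ζ / (2 * c.κ) := by
    rw [sinh_add, h₁, h₂, ← add_div, add_comm, cosh_add_sinh]
  obtain ⟨w, hw⟩ : ∃ w, w = -(c.α - β + 1) * c.η + ((N : ℂ) - 2 * j) * c.η - c.τ := ⟨_, rfl⟩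
  have hsw : sinh w = sinh (αm + βm) := by
    rw [gaugeFactor, ← exp_add, show -(c.α - β + 1) * c.η + ((N : ℂ) - 2 * j) * c.η = w + c.τ by
      rw [hw]; ring, exp_add, exp_neg] at h0
    rw [hs, sinh, exp_neg]
    have e₁ := exp_ne_zero w
    have e₂ := exp_ne_zero c.τ
    field_simp at h0 ⊢
    linear_combination -((mul_eq_zero.1 h0).resolve_left e₂)
  obtain ⟨k, hk⟩ := sinh_eq_sinh_imp hsw
  refine h k ?_
  linear_combination -hk + hw

theorem generic_of_ne (c : Chain N) (αm βm : ℂ)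
    (hξ : ∀ a b : Fin N, a ≠ b → ∀ r ∈ ({-1, 0, 1} : Set ℤ), ∀ k : ℤ,
      c.ξ a ≠ c.ξ b + r * c.η + k * (Real.pi * I))
    (hξ' : ∀ a b : Fin N, ∀ k : ℤ, c.ξ a + c.ξ b ≠ k * (Real.pi * I))
    (hA : ∀ n : Fin N, c.scalarA αm βm (c.η / 2 - c.ξ n) ≠ 0) : c.Generic where
  sinh_sub a b hab h := by
    obtain ⟨k, hk⟩ := sinh_eq_zero_imp h
    exact hξ a b hab 0 (by simp) k (by push_cast; linear_combination hk)
  sinh_sub_add a b hab h := by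
    obtain ⟨k, hk⟩ := sinh_eq_zero_imp h
    exact hξ a b hab (-1) (by simp) k (by push_cast; linear_combination hk)
  sinh_add a b h := by
    obtain ⟨k, hk⟩ := sinh_eq_zero_imp h
    exact hξ' a b k hk
  sinh_add_sub a b := by
    -- sinh(η-ξ_a-ξ_b) is the factor b of a(η/2-ξ_a), which divides the nonzero normalization.
    have h := right_ne_zero_of_mul (left_ne_zero_of_mul (hA a))
    have := Finset.prod_ne_zero_iff.1 h b (Finset.mem_univ b)
    rwa [show c.η / 2 - c.ξ a - c.ξ b + c.η / 2 = c.η - c.ξ a - c.ξ b by ring] at this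

theorem sinh_eta_ne_zero (c : Chain N) {αm βm : ℂ} {n : Fin N}
    (hA : c.scalarA αm βm (c.η / 2 - c.ξ n) ≠ 0) : sinh c.η ≠ 0 := by
  -- In d(-x) at x = η/2 - ξₙ the factor of site n is sinh(-η).
  have h := Finset.prod_ne_zero_iff.1 (right_ne_zero_of_mul hA) n (Finset.mem_univ n)
  rw [show -(c.η / 2 - c.ξ n) - c.η - c.ξ n + c.η / 2 = -c.η by ring, sinh_neg] at h
  exact neg_ne_zero.1 h

end Chain

end OpenXXZ

end

theorem mainTheorem4 {N : ℕ} (c : OpenXXZ.Chain N) (αm βm β : ℂ)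
    -- the matrix `K₋` and the parameters `α₋, β₋` are well defined
    (hζ : Complex.sinh c.ζ ≠ 0) (hκ : c.κ ≠ 0)
    (hαβ₁ : Complex.sinh αm * Complex.cosh βm = Complex.sinh c.ζ / (2 * c.κ))
    (hαβ₂ : Complex.cosh αm * Complex.sinh βm = Complex.cosh c.ζ / (2 * c.κ))
    -- generic inhomogeneities
    (hξ : ∀ a b : Fin N, a ≠ b → ∀ r ∈ ({-1, 0, 1} : Set ℤ), ∀ k : ℤ,
      c.ξ a ≠ c.ξ b + r * c.η + k * (Real.pi * Complex.I))
    (hξ' : ∀ a b : Fin N, ∀ k : ℤ, c.ξ a + c.ξ b ≠ k * (Real.pi * Complex.I))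
    -- the denominators in the definition of the states do not vanish
    (hA : ∀ n : Fin N, c.scalarA αm βm (c.η / 2 - c.ξ n) ≠ 0)
    -- the gauge transformations at `β` and at `β - 2` are invertible
    (hβ : Complex.sinh (β * c.η) ≠ 0) (hβ' : Complex.sinh ((β - 2) * c.η) ≠ 0) :
    (∀ (σ : Equiv.Perm (Fin N)) (h : Fin N → Fin 2),
      c.sovStateOrdered αm βm σ β h = c.sovState αm βm β h) ∧
    (∀ (h : Fin N → Fin 2) (x : ℂ),
      Matrix.vecMul (c.sovState αm βm β h) (c.opB x β) =
        c.pseudoEigenvalue h x β • c.sovState αm βm (β - 2) h) ∧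
    ((∀ j : Fin N, ∀ k : ℤ,
        (c.α - (β - 2 * (j : ℕ))) * c.η ≠
          ((N : ℂ) - 1) * c.η - c.τ - (-1 : ℂ) ^ k * (αm + βm) + k * (Real.pi * Complex.I)) →
      LinearIndependent ℂ (fun h : Fin N → Fin 2 => c.sovState αm βm β h) ∧
      Submodule.span ℂ (Set.range fun h : Fin N → Fin 2 => c.sovState αm βm β h) = ⊤) := by
  have hc := c.generic_of_ne αm βm hξ hξ' hA
  have hsov := fun {β : ℂ} (hβ : Complex.sinh (β * c.η) ≠ 0) h =>
    hc.sovStateOrdered_eq αm βm hβ 1 h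
  refine ⟨fun σ h => ?_, fun h x => ?_, fun hgen => ?_⟩
  · rw [OpenXXZ.Chain.sovState, hsov hβ, hc.sovStateOrdered_eq αm βm hβ]
  · have hnd : (OpenXXZ.Chain.occupied h (List.finRange N)).Nodup :=
      (List.nodup_finRange N).filter _
    have hT : Complex.exp (-(c.α - (β - 2) + 1) * c.η) =
        Complex.exp (-(c.α - β + 1) * c.η) * Complex.exp (-(2 * c.η)) := by
      rw [← Complex.exp_add]
      ring_nf
    rw [OpenXXZ.Chain.sovState, OpenXXZ.Chain.sovState, hsov hβ, hsov hβ', c.opB_eq hβ,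
      Matrix.smul_vecMul, Matrix.vecMul_smul, c.listState_vecMul_hatB _ _ hnd,
      OpenXXZ.Chain.indicator_occupied_finRange, hT, ← c.hatEigenvalue_eq β hζ]
    simp only [smul_smul]
    congr 1
    ring
  · have hli : LinearIndependent ℂ (fun h : Fin N → Fin 2 => c.sovState αm βm β h) := by
      have h₀ := hc.listState_linearIndependent hζ (fun hN => c.sinh_eta_ne_zero (hA ⟨0, hN⟩))
        (Complex.exp (-(c.α - β + 1) * c.η))
        (fun j hj => c.gaugeFactor_ne_zero hκ hαβ₁ hαβ₂ j (hgen ⟨j, hj⟩))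
      -- The normalized states are nonzero multiples of the list states, so independence carries
      -- over.
      have hu : ∀ h, c.stateScale αm βm h ≠ 0 := fun h =>
        Finset.prod_ne_zero_iff.2 fun n _ =>
          pow_ne_zero _ (mul_ne_zero (inv_ne_zero (hA n)) (Complex.exp_ne_zero _))
      have h₁ := h₀.units_smul fun h => Units.mk0 _ (hu h)
      convert h₁ using 1
      ext1 h
      exact hsov hβ h
    exact ⟨hli, hli.span_eq_top_of_card_eq_finrank' (by simp)⟩
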